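/- Let $\Gamma$ be a metric graph: a finite connected multigraph (loops and parallel edges allowed) in which each edge $e$ is given a positive real length and identified with an interval of that length. Its vertices are called branching points, $B(\Gamma)$ is the set of vertices, and $g=|E|-|V|+1$ is its genus. A divisor is an element $D=\sum_p D(p)\,(p)$ of the free abelian group on all points of $\Gamma$; its degree is $\sum_p D(p)$, and $D\ge 0$ means $D(p)\ge 0$ for all $p$. A rational function is a continuous function $f:\Gamma\to\mathbb R$ that is, on every edge, piecewise linear with finitely many pieces and integral slopes; $D_f=\sum_p \mathrm{ord}_f(p)\,(p)$, where $\mathrm{ord}_f(p)$ is the sum of the outgoing slopes of $f$ at $p$. Write $D\sim D'$ if $D=D'+D_f$ for some rational function $f$, let $|D|=\{F\ge 0: F\sim D\}$, and $$r(D)=\min\{\deg F-1 \;:\; F\ge 0,\ |D-F|=\emptyset\}.$$ Let $I$ be any loop transversal of $\Gamma$, i.e. a set consisting of exactly one interior point of each loop. A permutation (with respect to $I$) is a finite sequence $P$ of distinct points of $\Gamma$ whose support $\mathrm{supp}\,P$ contains $B(\Gamma)\cup I$. A $P$-segment is a nondegenerate closed subinterval of an edge whose two ends lie in $\mathrm{supp}\,P$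 and whose interior is disjoint from $\mathrm{supp}\,P$. For $v\in\mathrm{supp}\,P$ let $S_P(v)$ be the set of $P$-segments with one end at $v$ and the other end preceding $v$ in $P$, and put $$\nu_P=\sum_{v\in \mathrm{supp}\,P}\bigl(|S_P(v)|-1\bigr)(v).$$ Then: 1. For every divisor $D$ on $\Gamma$, exactly one of the following holds: (a) $r(D)\ge 0$; (b) $r(\nu_P-D)\ge 0$ for some permutation $P$. 2. Every non-special divisor $\nu$ on $\Gamma$ (that is, $\deg\nu=g-1$ and $|\nu|=\emptyset$) satisfies $\nu\sim\nu_P$ for some permutation $P$. -/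

import Mathlib

/-- A (finite, connected) metric graph with vertex set `V` and edge set `E`: a graph, loops and
parallel edges allowed, each of whose edges has a positive real length. The orientation `src`, `tgt`
of an edge only serves to parametrize it by the interval `[0, len e]`. -/
structure MetricGraph (V E : Type*) where
  src : E → V
  tgt : E → V
  len : E → ℝ
  len_pos : ∀ e, 0 < len e
  nonempty : Nonempty V
  connected : ∀ u v : V, Relation.ReflTransGen
    (fun x y => ∃ e, (src e = x ∧ tgt e = y) ∨ (src e = y ∧ tgt e = x)) u v

namespace MetricGraph

variable {V E : Type*}

/-- The points of the metric graph: the vertices (branching points) and, for each edge `e`,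
the internal points of `[0, len e]`. -/
inductive Point (G : MetricGraph V E) where
  | vertex (v : V) : Point G
  | internal (e : E) (t : ℝ) (ht : 0 < t ∧ t < G.len e) : Point G

open Classical in
/-- The parametrization of the edge `e`: for `t ∈ [0, len e]` the point of `e` at distance `t`
(measured on `e`) from the end `src e`; so `0` is identified with `src e` and `len e` with `tgt e`.
(Parameters outside `[0, len e]` are sent to the nearer end.) -/
noncomputable def pt (G : MetricGraph V E) (e : E) (t : ℝ) : G.Point :=
  if h : 0 < t ∧ t < G.len e then .internal e t h
  else if t ≤ 0 then .vertex (G.src e) else .vertex (G.tgt e)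

/-- The interior of the edge `e`. -/
def edgeInterior (G : MetricGraph V E) (e : E) : Set G.Point :=
  {p | ∃ t, ∃ ht : 0 < t ∧ t < G.len e, p = .internal e t ht}

/-- The genus `|E| - |V| + 1`. -/
def genus [Fintype V] [Fintype E] (_G : MetricGraph V E) : ℤ :=
  (Fintype.card E : ℤ) - (Fintype.card V : ℤ) + 1

/-- Divisors: the free abelian group on all points. The order `0 ≤ D` on it is pointwise. -/
abbrev Divisor (G : MetricGraph V E) : Type _ := G.Point →₀ ℤ

/-- The degree of a divisor. -/
def deg {G : MetricGraph V E} (D : G.Divisor) : ℤ := D.sum fun _ n => n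

/-- Rational functions: on every edge, outside finitely many parameters `S`, the function is linear
with integral slope. Linearity is required on closed subintervals whose interior misses `S`, so this
includes continuity on every edge, that is, continuity on the metric graph. -/
def IsRational (G : MetricGraph V E) (f : G.Point → ℝ) : Prop :=
  ∀ e : E, ∃ S : Finset ℝ, ∀ a b : ℝ, 0 ≤ a → a < b → b ≤ G.len e →
    (∀ s ∈ S, ¬ (a < s ∧ s < b)) →
    ∃ m : ℤ, ∀ t ∈ Set.Icc a b, f (G.pt e t) = f (G.pt e a) + m * (t - a)

/-- The outgoing slope of `f` at parameter `t` of `e` along the segment towards `tgt e`. -/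
noncomputable def slopeFwd (G : MetricGraph V E) (f : G.Point → ℝ) (e : E) (t : ℝ) : ℝ :=
  derivWithin (fun s => f (G.pt e s)) (Set.Ici t) t

/-- The outgoing slope of `f` at parameter `t` of `e` along the segment towards `src e`. -/
noncomputable def slopeBwd (G : MetricGraph V E) (f : G.Point → ℝ) (e : E) (t : ℝ) : ℝ :=
  - derivWithin (fun s => f (G.pt e s)) (Set.Iic t) t

open Classical in
/-- The order of `f` at a point: the sum of the outgoing slopes of all segments emanating from it.
A loop contributes both of its ends to the order at its vertex. -/
noncomputable def ord [Fintype E] (G : MetricGraph V E) (f : G.Point → ℝ) : G.Point → ℝ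
  | .vertex v => ∑ e : E, ((if G.src e = v then G.slopeFwd f e 0 else 0)
      + (if G.tgt e = v then G.slopeBwd f e (G.len e) else 0))
  | .internal e t _ => G.slopeFwd f e t + G.slopeBwd f e t

/-- Linear equivalence: `D = D' + D_f` for some rational function `f`, where `D_f(p) = ord_f p`. -/
def LinEquiv [Fintype E] {G : MetricGraph V E} (D D' : G.Divisor) : Prop :=
  ∃ f : G.Point → ℝ, G.IsRational f ∧ ∀ p, (D p : ℝ) = (D' p : ℝ) + G.ord f p

/-- The complete linear system `|D|`: the effective divisors equivalent to `D`. -/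
def linearSystem [Fintype E] {G : MetricGraph V E} (D : G.Divisor) : Set G.Divisor :=
  {F | 0 ≤ F ∧ LinEquiv F D}

/-- The rank: the minimum of `deg F - 1` over all effective `F` with `|D - F| = ∅`. -/
noncomputable def rank [Fintype E] {G : MetricGraph V E} (D : G.Divisor) : ℤ :=
  sInf {n : ℤ | ∃ F : G.Divisor, 0 ≤ F ∧ linearSystem (D - F) = ∅ ∧ n = deg F - 1}

/-- Non-special divisors: degree `g - 1` and empty linear system. -/
def IsNonSpecial [Fintype V] [Fintype E] {G : MetricGraph V E} (D : G.Divisor) : Prop :=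
  deg D = G.genus - 1 ∧ linearSystem D = ∅

/-- A loop transversal: a set with exactly one interior point of every loop and no other
elements. -/
def IsLoopTransversal (G : MetricGraph V E) (I : Set G.Point) : Prop :=
  (∀ p ∈ I, ∃ e, G.src e = G.tgt e ∧ p ∈ G.edgeInterior e) ∧
  ∀ e, G.src e = G.tgt e → ∃! p, p ∈ I ∧ p ∈ G.edgeInterior e

/-- A permutation of points (with respect to `I`): a finite sequence of distinct points that
contains all vertices and all elements of `I`. -/
structure Permutation (G : MetricGraph V E) (I : Set G.Point) where
  toList : List G.Point
  nodup : toList.Nodup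
  vertex_mem : ∀ v, Point.vertex v ∈ toList
  transversal_mem : ∀ p ∈ I, p ∈ toList

/-- A segment, i.e. the subinterval `[lo, hi]` of the edge `edge`. -/
structure Segment (G : MetricGraph V E) where
  edge : E
  lo : ℝ
  hi : ℝ
  lo_nonneg : 0 ≤ lo
  lo_lt_hi : lo < hi
  hi_le : hi ≤ G.len edge

namespace Permutation

variable {G : MetricGraph V E} {I : Set G.Point}

open Classical in
/-- The linear order on the support: `p` occurs before `q`. -/
def Precedes (P : G.Permutation I) (p q : G.Point) : Prop :=
  p ∈ P.toList ∧ q ∈ P.toList ∧ P.toList.idxOf p < P.toList.idxOf q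

/-- `P`-segments: both ends are in the support, the interior is disjoint from it. -/
def IsPSegment (P : G.Permutation I) (L : G.Segment) : Prop :=
  G.pt L.edge L.lo ∈ P.toList ∧ G.pt L.edge L.hi ∈ P.toList ∧
    ∀ t, L.lo < t → t < L.hi → G.pt L.edge t ∉ P.toList

/-- `S_P(v)`: the `P`-segments with one end at `v` and the other end preceding `v`. -/
def segs (P : G.Permutation I) (v : G.Point) : Set G.Segment :=
  {L | P.IsPSegment L ∧
    ((G.pt L.edge L.lo = v ∧ P.Precedes (G.pt L.edge L.hi) v) ∨
      (G.pt L.edge L.hi = v ∧ P.Precedes (G.pt L.edge L.lo) v))}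

open Classical in
/-- The divisor `ν_P`, the sum of `(|S_P(v)| - 1) (v)` over `v` in the support of `P`. -/
noncomputable def nu (P : G.Permutation I) : G.Divisor :=
  ∑ v ∈ P.toList.toFinset, Finsupp.single v (((P.segs v).ncard : ℤ) - 1)

end Permutation

end MetricGraph

/-! Two facts carry the theorem.

First, $|\nu_P|=\emptyset$ (`linearSystem_nu_eq_empty`). Suppose $\nu_P+D_f\ge 0$. Inside every
$P$-segment all orders of $f$ are nonnegative, so $f$ is convex there, and its outgoing slope at an
end is at most the mean slope. Let $p$ be the earliest point of the support at which $f$ is maximal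
among points of the support. Every slope out of $p$ is at most $0$, and at most $-1$ towards a
predecessor, where $f$ is strictly smaller. So $\mathrm{ord}_f(p)\le-|S_P(p)|$, and the coefficient
at $p$ is at most $-1$, a contradiction.

Second, if $|D|=\emptyset$, then some $D'\sim D$ lies below some $\nu_P$ (`exists_linEquiv_le_nu`).
Cut $\Gamma$ at a finite set $S$ containing the vertices, $I$ and $\mathrm{supp}\,D$. A real
potential $u$ on $S$ extends to a rational function that is convex on each segment, with slopes
$\lfloor q\rfloor$ and $\lfloor q\rfloor+1$ for the mean slope $q$. It adds one chip at the bend of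
each segment with $q\notin\mathbb Z$ and the floored Laplacian of $u$ on $S$. Among the potentials
that vanish at $v_0$ and leave $D'$ effective on $S\setminus\{v_0\}$ there is a greatest one. As it
cannot be raised on any set $A\not\ni v_0$, some $s\in A$ has fewer chips than integral segments
leaving $A$. Dhar's burning algorithm turns this into an order of $S$ starting at $v_0$; placing the
bends last gives $P$. Then $D'\le\nu_P$: at $v_0$ because $|D|=\emptyset$ forces $D'(v_0)\le-1$, on
the rest of $S$ by burning, and at a bend because both halves of its segment count there.

The first fact excludes (a) and (b) together, as effective representatives would add up to one of
$\nu_P$. The second gives (b) when (a) fails. It also gives part 2, since $\deg\nu_P=g-1$ turns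
$D'\le\nu_P$ into equality. -/

namespace WeightedMultigraph

/-! ### Potential theory on weighted multigraphs and reduced potentials -/

variable {S Λ : Type*} [Fintype Λ] (a b : Λ → S) (ℓ : Λ → ℝ)

open Classical in
/-- The weighted graph Laplacian of the multigraph with edges `Λ`, ends `a`, `b`, lengths `ℓ`. -/
noncomputable def laplacian : (S → ℝ) →ₗ[ℝ] (S → ℝ) where
  toFun u s := ∑ L, ((if a L = s then (u (b L) - u s) / ℓ L else 0) +
    (if b L = s then (u (a L) - u s) / ℓ L else 0))
  map_add' u v := by
    funext s
    simp only [Pi.add_apply, ← Finset.sum_add_distrib]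
    refine Finset.sum_congr rfl fun L _ => ?_
    split_ifs <;> ring
  map_smul' c u := by
    funext s
    simp only [Pi.smul_apply, smul_eq_mul, Finset.mul_sum, RingHom.id_apply]
    refine Finset.sum_congr rfl fun L _ => ?_
    split_ifs <;> ring

open Classical in
/-- The Laplacian with slopes rounded down to integers. -/
noncomputable def floorLaplacian (u : S → ℝ) (s : S) : ℤ :=
  ∑ L, ((if a L = s then ⌊(u (b L) - u s) / ℓ L⌋ else 0) +
    (if b L = s then ⌊(u (a L) - u s) / ℓ L⌋ else 0))

/-- No nonempty set of nodes avoiding `v₀` is closed under adjacency. -/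
def CutConnected (v₀ : S) : Prop :=
  ∀ A : Set S, A.Nonempty → v₀ ∉ A → ∃ L, (a L ∈ A ∧ b L ∉ A) ∨ (b L ∈ A ∧ a L ∉ A)

open Classical in
/-- The edges of integral slope that join `s` to a node in `B`. -/
noncomputable def integralEdges (u : S → ℝ) (s : S) (B : Set S) : Finset Λ :=
  {L | (∃ k : ℤ, u (b L) - u (a L) = k * ℓ L) ∧ ((a L = s ∧ b L ∈ B) ∨ (b L = s ∧ a L ∈ B))}

variable {a b ℓ} {v₀ : S}

/-- If the maximum were positive, the set of maximizers would avoid `v₀`, so some edge would leave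
it. At the end of that edge the Laplacian is a sum of nonpositive terms, one of them negative. -/
theorem laplacian_maximum_principle [Finite S] (hℓ : ∀ L, 0 < ℓ L) (hc : CutConnected a b v₀)
    {u : S → ℝ} (hu : ∀ s, s ≠ v₀ → 0 ≤ laplacian a b ℓ u s) (h₀ : u v₀ ≤ 0) (s : S) :
    u s ≤ 0 := by
  classical
  have : Nonempty S := ⟨v₀⟩
  obtain ⟨s₀, hs₀⟩ := Finite.exists_max u
  by_contra! hs
  have hpos : 0 < u s₀ := hs.trans_le (hs₀ s)
  have hv : v₀ ∉ {t | u t = u s₀} := fun h => by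
    have : u v₀ = u s₀ := h
    linarith
  obtain ⟨L, hL⟩ := hc {t | u t = u s₀} ⟨s₀, rfl⟩ hv
  have key : ∀ t, u t = u s₀ → (∃ L, (a L = t ∧ u (b L) ≠ u s₀) ∨ (b L = t ∧ u (a L) ≠ u s₀)) →
      False := by
    intro t ht ⟨L, hL⟩
    have ht₀ : t ≠ v₀ := fun h => hv (h ▸ ht)
    have h1 : ∀ w K, (u w - u t) / ℓ K ≤ 0 := fun w K =>
      div_nonpos_of_nonpos_of_nonneg (by linarith [hs₀ w]) (hℓ K).le
    have h2 : ∀ w K, u w ≠ u s₀ → (u w - u t) / ℓ K < 0 := fun w K hw =>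
      div_neg_of_neg_of_pos (by linarith [lt_of_le_of_ne (hs₀ w) hw]) (hℓ K)
    refine (hu t ht₀).not_gt (Finset.sum_neg' (fun K _ => ?_) ⟨L, Finset.mem_univ _, ?_⟩)
    · split_ifs <;> linarith [h1 (a K) K, h1 (b K) K]
    · rcases hL with ⟨h, h'⟩ | ⟨h, h'⟩
      · rw [if_pos h]
        split_ifs <;> linarith [h1 (a L) L, h2 (b L) L h']
      · rw [if_pos h]
        split_ifs <;> linarith [h1 (b L) L, h2 (a L) L h']
  rcases hL with ⟨h, h'⟩ | ⟨h, h'⟩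
  · exact key _ h ⟨L, .inl ⟨rfl, h'⟩⟩
  · exact key _ h ⟨L, .inr ⟨rfl, h'⟩⟩

/-- The maximum principle, applied to `u` and `-u`, makes the square linear system injective, hence
surjective. -/
theorem exists_dirichlet_solution [Finite S] (hℓ : ∀ L, 0 < ℓ L) (hc : CutConnected a b v₀)
    (g : S → ℝ) : ∃ u : S → ℝ, u v₀ = 0 ∧ ∀ s, s ≠ v₀ → laplacian a b ℓ u s = g s := by
  classical
  let T : (S → ℝ) →ₗ[ℝ] (S → ℝ) :=
    { toFun := fun u s => if s = v₀ then u v₀ else laplacian a b ℓ u s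
      map_add' := fun u v => by funext s; simp only [map_add, Pi.add_apply]; split_ifs <;> rfl
      map_smul' := fun c u => by
        funext s
        simp only [map_smul, Pi.smul_apply, RingHom.id_apply, smul_ite] }
  have hT : ∀ u s, T u s = if s = v₀ then u v₀ else laplacian a b ℓ u s := fun _ _ => rfl
  have hinj : Function.Injective T := by
    refine (injective_iff_map_eq_zero T).2 fun u hu => ?_
    have h0 : u v₀ = 0 := by simpa [hT] using congrFun hu v₀
    have h1 : ∀ s, s ≠ v₀ → laplacian a b ℓ u s = 0 := fun s hs => by
      simpa [hT, hs] using congrFun hu s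
    funext s
    refine le_antisymm (laplacian_maximum_principle hℓ hc (fun s hs => (h1 s hs).ge) h0.le s) ?_
    have := laplacian_maximum_principle (u := -u) hℓ hc
      (fun s hs => by rw [map_neg, Pi.neg_apply, h1 s hs, neg_zero]) (by simp [h0]) s
    simpa using this
  obtain ⟨u, hu⟩ := LinearMap.injective_iff_surjective.1 hinj (fun s => if s = v₀ then 0 else g s)
  refine ⟨u, by simpa [hT] using congrFun hu v₀, fun s hs => ?_⟩
  simpa [hT, hs] using congrFun hu s

theorem floorLaplacian_le_laplacian (u : S → ℝ) (s : S) :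
    (floorLaplacian a b ℓ u s : ℝ) ≤ laplacian a b ℓ u s := by
  classical
  unfold floorLaplacian laplacian
  push_cast
  refine Finset.sum_le_sum fun L _ => add_le_add ?_ ?_
  · split_ifs
    exacts [Int.floor_le _, le_rfl]
  · split_ifs
    exacts [Int.floor_le _, le_rfl]

/-- Each edge contributes at most two floored terms, and each loses less than one; this is the
constant. -/
theorem laplacian_sub_le_floorLaplacian (u : S → ℝ) (s : S) :
    laplacian a b ℓ u s - 2 * Fintype.card Λ ≤ floorLaplacian a b ℓ u s := by
  classical
  have h : ∑ _L : Λ, (2 : ℝ) = 2 * Fintype.card Λ := by simp [mul_comm]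
  unfold floorLaplacian laplacian
  rw [← h]
  simp only [LinearMap.coe_mk, AddHom.coe_mk]
  rw [← Finset.sum_sub_distrib]
  push_cast
  refine Finset.sum_le_sum fun L _ => ?_
  have h1 := Int.sub_one_lt_floor ((u (b L) - u s) / ℓ L)
  have h2 := Int.sub_one_lt_floor ((u (a L) - u s) / ℓ L)
  split_ifs <;> linarith

/-- The potentials that vanish at `v₀` and make `D` effective away from `v₀`. -/
def admissible (a b : Λ → S) (ℓ : Λ → ℝ) (v₀ : S) (D : S → ℤ) : Set (S → ℝ) :=
  {u | u v₀ = 0 ∧ ∀ s, s ≠ v₀ → 0 ≤ D s + floorLaplacian a b ℓ u s}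

theorem admissible_nonempty [Finite S] (hℓ : ∀ L, 0 < ℓ L) (hc : CutConnected a b v₀)
    (D : S → ℤ) : (admissible a b ℓ v₀ D).Nonempty := by
  -- The margin `2 * Fintype.card Λ` absorbs all rounding losses.
  obtain ⟨u, h0, hu⟩ := exists_dirichlet_solution hℓ hc (fun s => 2 * Fintype.card Λ - D s)
  refine ⟨u, h0, fun s hs => ?_⟩
  have := laplacian_sub_le_floorLaplacian (a := a) (b := b) (ℓ := ℓ) u s
  rw [hu s hs] at this
  have h : (0 : ℝ) ≤ ((D s + floorLaplacian a b ℓ u s : ℤ) : ℝ) := by push_cast; linarith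
  exact_mod_cast h

/-- An admissible potential has true Laplacian at least `-D` away from `v₀`, so the maximum
principle bounds it by the Dirichlet solution with Laplacian exactly `-D`. -/
theorem admissible_bddAbove [Finite S] (hℓ : ∀ L, 0 < ℓ L) (hc : CutConnected a b v₀)
    (D : S → ℤ) : ∃ h : S → ℝ, ∀ u ∈ admissible a b ℓ v₀ D, ∀ s, u s ≤ h s := by
  obtain ⟨h, h0, hh⟩ := exists_dirichlet_solution hℓ hc (fun s => -(D s : ℝ))
  refine ⟨h, fun u hu s => ?_⟩
  have := laplacian_maximum_principle (u := u - h) hℓ hc (fun s hs => ?_)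
    (by simp [h0, hu.1]) s
  · simpa using this
  · rw [map_sub, Pi.sub_apply, hh s hs]
    have h1 := hu.2 s hs
    have h2 := floorLaplacian_le_laplacian (a := a) (b := b) (ℓ := ℓ) u s
    have h3 : (0 : ℝ) ≤ D s + floorLaplacian a b ℓ u s := by exact_mod_cast h1
    linarith

open Filter Topology in
theorem eventually_floor_sub_div_le (c y l : ℝ) :
    ∀ᶠ x in 𝓝 y, ⌊(c - x) / l⌋ ≤ ⌊(c - y) / l⌋ := by
  have hcont : ContinuousAt (fun x => (c - x) / l) y := by fun_prop
  filter_upwards [hcont.eventually_lt continuousAt_const (Int.lt_floor_add_one ((c - y) / l))]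
    with x hx
  exact Int.le_of_lt_add_one (Int.floor_lt.2 (by exact_mod_cast hx))

open Filter Topology in
theorem eventually_le_floor_sub_div (y l : ℝ) {k : ℤ} (hk : (k : ℝ) < y / l) :
    ∀ᶠ x in 𝓝 (0 : ℝ), k ≤ ⌊(y - x) / l⌋ := by
  have hcont : ContinuousAt (fun x => (y - x) / l) 0 := by fun_prop
  have : (k : ℝ) < (y - 0) / l := by simpa using hk
  filter_upwards [continuousAt_const.eventually_lt hcont this] with x hx
  exact Int.le_floor.2 hx.le

/-- The pointwise supremum is itself admissible: raising neighbours only raises the floors at `s`,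
and upper semicontinuity of the floor controls the passage to the limit of the value at `s`. -/
theorem exists_greatest_admissible [Finite S] (hℓ : ∀ L, 0 < ℓ L) (hc : CutConnected a b v₀)
    (D : S → ℤ) :
    ∃ u ∈ admissible a b ℓ v₀ D, ∀ w ∈ admissible a b ℓ v₀ D, ∀ s, w s ≤ u s := by
  classical
  obtain ⟨h, hh⟩ := admissible_bddAbove hℓ hc D
  obtain ⟨w₀, hw₀⟩ := admissible_nonempty hℓ hc D
  set R := admissible a b ℓ v₀ D
  let u : S → ℝ := fun s => sSup ((fun w : S → ℝ => w s) '' R)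
  have hbdd : ∀ s, BddAbove ((fun w : S → ℝ => w s) '' R) := fun s =>
    ⟨h s, by rintro _ ⟨w, hw, rfl⟩; exact hh w hw s⟩
  have hle : ∀ w ∈ R, ∀ s, w s ≤ u s := fun w hw s => le_csSup (hbdd s) ⟨w, hw, rfl⟩
  refine ⟨u, ⟨?_, fun s hs => ?_⟩, hle⟩
  · refine le_antisymm (csSup_le ⟨_, w₀, hw₀, rfl⟩ ?_) ?_
    · rintro _ ⟨w, hw, rfl⟩
      exact hw.1.le
    · exact hw₀.1.ge.trans (hle w₀ hw₀ v₀)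
  -- One admissible `w` nearly optimal at this `s` suffices, since the other values of `u` dominate
  -- those of `w`.
  · have hev : ∀ᶠ x in nhds (u s), ∀ L, ⌊(u (b L) - x) / ℓ L⌋ ≤ ⌊(u (b L) - u s) / ℓ L⌋ ∧
        ⌊(u (a L) - x) / ℓ L⌋ ≤ ⌊(u (a L) - u s) / ℓ L⌋ :=
      Filter.eventually_all.2 fun L =>
        (eventually_floor_sub_div_le _ _ _).and (eventually_floor_sub_div_le _ _ _)
    obtain ⟨δ, hδ, hball⟩ := Metric.eventually_nhds_iff.1 hev
    obtain ⟨_, ⟨w, hw, rfl⟩, hlt⟩ := exists_lt_of_lt_csSup (s := (fun w : S → ℝ => w s) '' R)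
      ⟨_, w₀, hw₀, rfl⟩ (sub_lt_self (u s) hδ)
    have hws := hle w hw s
    have hx := hball (y := w s) (by
      rw [Real.dist_eq, abs_lt]
      constructor <;> simp only at hlt <;> linarith)
    refine (hw.2 s hs).trans (add_le_add le_rfl (Finset.sum_le_sum fun L _ => add_le_add ?_ ?_))
    · split_ifs
      · refine le_trans (Int.floor_le_floor ?_) (hx L).1
        exact div_le_div_of_nonneg_right (by linarith [hle w hw (b L)]) (hℓ L).le
      · exact le_rfl
    · split_ifs
      · refine le_trans (Int.floor_le_floor ?_) (hx L).2
        exact div_le_div_of_nonneg_right (by linarith [hle w hw (a L)]) (hℓ L).le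
      · exact le_rfl

/-- If every `s ∈ A` had a chip for each integral edge leaving `A`, the greatest admissible
potential could be raised slightly on `A`. -/
theorem exists_reduced_potential [Finite S] (hℓ : ∀ L, 0 < ℓ L) (hc : CutConnected a b v₀)
    (D : S → ℤ) :
    ∃ u : S → ℝ, (∀ s, s ≠ v₀ → 0 ≤ D s + floorLaplacian a b ℓ u s) ∧
      ∀ A : Set S, A.Nonempty → v₀ ∉ A →
        ∃ s ∈ A, D s + floorLaplacian a b ℓ u s < (integralEdges a b ℓ u s Aᶜ).card := by
  classical
  obtain ⟨u, hu, hmax⟩ := exists_greatest_admissible hℓ hc D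
  refine ⟨u, hu.2, fun A ⟨s₀, hs₀⟩ hA => ?_⟩
  by_contra! hcon
  -- A small perturbation lowers the floor of a slope by at most one, and only if that slope is an
  -- integer.
  have hstep : ∀ (y : ℝ) (L : Λ), ∀ᶠ x in nhds (0 : ℝ),
      ⌊y / ℓ L⌋ - (if ∃ k : ℤ, y = k * ℓ L then 1 else 0) ≤ ⌊(y - x) / ℓ L⌋ := by
    intro y L
    refine eventually_le_floor_sub_div _ _ ?_
    split_ifs with hk
    · push_cast
      linarith [Int.floor_le (y / ℓ L)]
    · push_cast
      rw [sub_zero]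
      refine lt_of_le_of_ne (Int.floor_le _) fun h => hk ⟨⌊y / ℓ L⌋, ?_⟩
      rw [h, div_mul_cancel₀ _ (hℓ L).ne']
  have hev : ∀ᶠ x in nhds (0 : ℝ), ∀ L,
      ⌊(u (b L) - u (a L)) / ℓ L⌋ - (if ∃ k : ℤ, u (b L) - u (a L) = k * ℓ L then 1 else 0)
        ≤ ⌊(u (b L) - u (a L) - x) / ℓ L⌋ ∧
      ⌊(u (a L) - u (b L)) / ℓ L⌋ - (if ∃ k : ℤ, u (a L) - u (b L) = k * ℓ L then 1 else 0)
        ≤ ⌊(u (a L) - u (b L) - x) / ℓ L⌋ :=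
    Filter.eventually_all.2 fun L => (hstep _ L).and (hstep _ L)
  obtain ⟨δ, hδ, hball⟩ := Metric.eventually_nhds_iff.1 hev
  have hε := hball (y := δ / 2) (by rw [Real.dist_eq, sub_zero, abs_of_pos] <;> linarith)
  have hsymm : ∀ L, (∃ k : ℤ, u (a L) - u (b L) = k * ℓ L) ↔
      ∃ k : ℤ, u (b L) - u (a L) = k * ℓ L := fun L =>
    ⟨fun ⟨k, hk⟩ => ⟨-k, by push_cast; linarith⟩, fun ⟨k, hk⟩ => ⟨-k, by push_cast; linarith⟩⟩
  simp only [hsymm] at hε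
  let w : S → ℝ := fun s => u s + if s ∈ A then δ / 2 else 0
  have hwA : ∀ s ∈ A, w s = u s + δ / 2 := fun s hs => by simp [w, hs]
  have hwA' : ∀ s ∉ A, w s = u s := fun s hs => by simp [w, hs]
  have hwle : ∀ s, u s ≤ w s := fun s => by
    by_cases hs : s ∈ A
    · rw [hwA s hs]; linarith
    · rw [hwA' s hs]
  have hw : w ∈ admissible a b ℓ v₀ D := by
    refine ⟨by rw [hwA' _ hA, hu.1], fun s hs => ?_⟩
    -- In `A` the loss is at most one per integral edge to the complement, which `hcon` pays for.
    -- Outside `A` only neighbours rise, so nothing is lost.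
    by_cases hsA : s ∈ A
    · refine le_trans ?_ (add_le_add (le_refl (D s)) (?_ : floorLaplacian a b ℓ u s -
        (integralEdges a b ℓ u s Aᶜ).card ≤ floorLaplacian a b ℓ w s))
      · have := hcon s hsA
        linarith
      · unfold floorLaplacian integralEdges
        rw [Finset.card_filter]
        push_cast
        rw [← Finset.sum_sub_distrib]
        refine Finset.sum_le_sum fun L _ => ?_
        have h1 := (hε L).1
        have h2 := (hε L).2
        rw [sub_sub] at h1 h2
        by_cases ha : a L = s <;> by_cases hb : b L = s
        · have e1 : w (a L) = w s := by rw [ha]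
          have e2 : w (b L) = w s := by rw [hb]
          have e3 : u (a L) = u s := by rw [ha]
          have e4 : u (b L) = u s := by rw [hb]
          rw [e1, e2, e3, e4]
          simp only [sub_self, zero_div, Int.floor_zero, ite_self, add_zero]
          split_ifs <;> norm_num
        · by_cases hbA : b L ∈ A
          · simp [ha, hb, hbA, hwA s hsA, hwA _ hbA]
          · simp only [ha, hb, if_true, if_false, Set.mem_compl_iff, hbA, not_false_eq_true,
              and_true, or_false, false_and, and_self, add_zero, hwA s hsA,
              hwA' _ hbA] at h1 ⊢
            exact h1
        · by_cases haA : a L ∈ A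
          · simp [ha, hb, haA, hwA s hsA, hwA _ haA]
          · simp only [ha, hb, if_true, if_false, Set.mem_compl_iff, haA, not_false_eq_true,
              and_true, false_or, false_and, and_self, zero_add, hwA s hsA,
              hwA' _ haA] at h2 ⊢
            exact h2
        · simp [ha, hb]
    · refine (hu.2 s hs).trans (add_le_add le_rfl (Finset.sum_le_sum fun L _ => add_le_add ?_ ?_))
      · split_ifs
        · rw [hwA' s hsA]
          exact Int.floor_le_floor
            (div_le_div_of_nonneg_right (by linarith [hwle (b L)]) (hℓ L).le)
        · exact le_rfl
      · split_ifs
        · rw [hwA' s hsA]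
          exact Int.floor_le_floor
            (div_le_div_of_nonneg_right (by linarith [hwle (a L)]) (hℓ L).le)
        · exact le_rfl
  have := hmax w hw s₀
  rw [hwA s₀ hs₀] at this
  linarith

end WeightedMultigraph

/-! ### Dhar's burning order -/

/-- If every nonempty set of nodes that avoids `v₀` has a member related to its complement, all
nodes can be listed, from `v₀` on, so that each is related to the set of its predecessors. -/
theorem exists_burning_order {S : Type*} [Fintype S] [BEq S] [LawfulBEq S] (v₀ : S)
    (burns : S → Set S → Prop)
    (h : ∀ A : Set S, A.Nonempty → v₀ ∉ A → ∃ s ∈ A, burns s Aᶜ) :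
    ∃ l : List S, l.Nodup ∧ (∀ s, s ∈ l) ∧
      ∀ s, s ≠ v₀ → burns s {w | l.idxOf w < l.idxOf s} := by
  classical
  have key : ∀ n ≤ Fintype.card S, 1 ≤ n → ∃ l : List S, l.Nodup ∧ l.length = n ∧ v₀ ∈ l ∧
      ∀ s ∈ l, s ≠ v₀ → burns s {w | l.idxOf w < l.idxOf s} := by
    intro n
    induction n with
    | zero => intro _ h; omega
    | succ n ih =>
      intro hn _
      rcases Nat.eq_zero_or_pos n with rfl | hpos
      · exact ⟨[v₀], by simp, rfl, by simp, fun s hs hs' => absurd (by simpa using hs) hs'⟩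
      · obtain ⟨l, hnd, hlen, hv, hb⟩ := ih (by omega) hpos
        have hne : ({s | s ∉ l} : Set S).Nonempty := by
          by_contra hcon
          rw [Set.not_nonempty_iff_eq_empty, Set.eq_empty_iff_forall_notMem] at hcon
          have : (Finset.univ : Finset S) ⊆ l.toFinset := fun s _ => by
            simpa using hcon s
          have := (Finset.card_le_card this).trans (List.toFinset_card_le l)
          rw [Finset.card_univ] at this
          omega
        obtain ⟨s, hs, hsb⟩ := h {s | s ∉ l} hne (fun h => h hv)
        refine ⟨l ++ [s], ?_, by simp [hlen], by simp [hv], ?_⟩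
        · rw [List.nodup_append]
          refine ⟨hnd, by simp, ?_⟩
          rintro x hx y hy rfl
          exact hs (by simp_all)
        · intro t ht htv
          rw [List.mem_append, List.mem_singleton] at ht
          by_cases htl : t ∈ l
          -- Elements missing from a list have its length as index, so they never count as
          -- predecessors of a listed element.
          · have : {w | (l ++ [s]).idxOf w < (l ++ [s]).idxOf t} =
                {w | l.idxOf w < l.idxOf t} := by
              ext w
              simp only [Set.mem_ofPred_eq, List.idxOf_append, htl, if_true]
              split_ifs with hw
              · rfl
              · have := List.idxOf_lt_length_iff.2 htl
                rw [List.idxOf_eq_length hw]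
                omega
            rw [this]
            exact hb t htl htv
          · obtain rfl : t = s := by tauto
            have : {w | (l ++ [t]).idxOf w < (l ++ [t]).idxOf t} = {s | s ∉ l}ᶜ := by
              ext w
              simp only [Set.mem_ofPred_eq, List.idxOf_append, htl, if_false, Set.mem_compl_iff,
                not_not]
              split_ifs with hw
              · have := List.idxOf_lt_length_iff.2 hw
                simp only [hw, iff_true]
                omega
              · simp [hw]
            rw [this]
            exact hsb
  obtain ⟨l, hnd, hlen, -, hb⟩ := key (Fintype.card S) le_rfl (Fintype.card_pos_iff.2 ⟨v₀⟩)
  have hmem : ∀ s, s ∈ l := by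
    have : l.toFinset = Finset.univ :=
      (Finset.card_eq_iff_eq_univ _).1 (by rw [List.toFinset_card_of_nodup hnd, hlen])
    intro s
    rw [← List.mem_toFinset, this]
    exact Finset.mem_univ s
  exact ⟨l, hnd, hmem, fun s => hb s (hmem s)⟩

/-! ### Segments cut out by a finite set of points -/

namespace MetricGraph

variable {V E : Type*} {G : MetricGraph V E}

theorem pt_of_mem_Ioo {e : E} {t : ℝ} (h : 0 < t ∧ t < G.len e) : G.pt e t = .internal e t h :=
  dif_pos h

theorem pt_zero (e : E) : G.pt e 0 = .vertex (G.src e) := by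
  simp [pt]

theorem pt_len (e : E) : G.pt e (G.len e) = .vertex (G.tgt e) := by
  simp [pt, G.len_pos e]

theorem pt_eq_vertex_iff_of_lt {e : E} {t : ℝ} (h0 : 0 ≤ t) (h1 : t < G.len e) {v : V} :
    G.pt e t = .vertex v ↔ t = 0 ∧ G.src e = v := by
  rcases h0.eq_or_lt with rfl | h0
  · simp [pt_zero]
  · simp [pt_of_mem_Ioo ⟨h0, h1⟩, h0.ne']

theorem pt_eq_vertex_iff_of_pos {e : E} {t : ℝ} (h0 : 0 < t) (h1 : t ≤ G.len e) {v : V} :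
    G.pt e t = .vertex v ↔ t = G.len e ∧ G.tgt e = v := by
  rcases h1.eq_or_lt with rfl | h1
  · simp [pt_len]
  · simp [pt_of_mem_Ioo ⟨h0, h1⟩, h1.ne]

theorem pt_eq_internal_iff {e e' : E} {t t' : ℝ} {h : 0 < t' ∧ t' < G.len e'} :
    G.pt e t = .internal e' t' h ↔ e = e' ∧ t = t' := by
  unfold pt
  split_ifs with h1 h2
  · simp
  · simp only [false_iff]
    rintro ⟨rfl, rfl⟩
    exact h1 h
  · simp only [false_iff]
    rintro ⟨rfl, rfl⟩
    exact h1 h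

/-- The segments cut out by a set of points. -/
def IsSegmentOf (S : Set G.Point) (L : G.Segment) : Prop :=
  G.pt L.edge L.lo ∈ S ∧ G.pt L.edge L.hi ∈ S ∧ ∀ t, L.lo < t → t < L.hi → G.pt L.edge t ∉ S

/-- The parameters on an edge of the points of `S`. -/
def params (S : Set G.Point) (e : E) : Set ℝ :=
  {t | 0 ≤ t ∧ t ≤ G.len e ∧ G.pt e t ∈ S}

/-- The parametrization is injective inside an edge; the two ends are treated apart because on a
loop they are the same point. -/
theorem params_finite {S : Set G.Point} (hS : S.Finite) (e : E) : (params S e).Finite := by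
  have h1 : (Set.Ioo 0 (G.len e) ∩ G.pt e ⁻¹' S).Finite := by
    refine Set.Finite.of_finite_image (f := G.pt e) (hS.subset ?_) ?_
    · rintro _ ⟨t, ht, rfl⟩
      exact ht.2
    · rintro t ⟨ht, -⟩ t' ⟨ht', -⟩ h
      rw [pt_of_mem_Ioo ht'] at h
      exact (pt_eq_internal_iff.1 h).2
  refine (h1.union (Set.toFinite {0, G.len e})).subset fun t ⟨h0, h1, hm⟩ => ?_
  rcases h0.eq_or_lt with rfl | h0
  · simp
  rcases h1.eq_or_lt with rfl | h1
  · simp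
  exact .inl ⟨⟨h0, h1⟩, hm⟩

theorem zero_mem_params {S : Set G.Point} (hV : ∀ v, Point.vertex v ∈ S) (e : E) :
    0 ∈ params S e :=
  ⟨le_rfl, (G.len_pos e).le, by rw [pt_zero]; exact hV _⟩

theorem len_mem_params {S : Set G.Point} (hV : ∀ v, Point.vertex v ∈ S) (e : E) :
    G.len e ∈ params S e :=
  ⟨(G.len_pos e).le, le_rfl, by rw [pt_len]; exact hV _⟩

theorem exists_segment_lo {S : Set G.Point} (hS : S.Finite) (hV : ∀ v, Point.vertex v ∈ S)
    {e : E} {t : ℝ} (ht : t ∈ params S e) (hlt : t < G.len e) :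
    ∃ L, IsSegmentOf S L ∧ L.edge = e ∧ L.lo = t := by
  obtain ⟨r, ⟨hr, htr⟩, hmin⟩ := Set.exists_min_image (params S e ∩ Set.Ioi t) id
    ((params_finite hS e).inter_of_left _) ⟨G.len e, len_mem_params hV e, hlt⟩
  refine ⟨⟨e, t, r, ht.1, htr, hr.2.1⟩, ⟨ht.2.2, hr.2.2, fun x hx hx' hxS => ?_⟩, rfl, rfl⟩
  exact (hmin x ⟨⟨ht.1.trans hx.le, hx'.le.trans hr.2.1, hxS⟩, hx⟩).not_gt hx'

theorem exists_segment_hi {S : Set G.Point} (hS : S.Finite) (hV : ∀ v, Point.vertex v ∈ S)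
    {e : E} {t : ℝ} (ht : t ∈ params S e) (hlt : 0 < t) :
    ∃ L, IsSegmentOf S L ∧ L.edge = e ∧ L.hi = t := by
  obtain ⟨r, ⟨hr, htr⟩, hmax⟩ := Set.exists_max_image (params S e ∩ Set.Iio t) id
    ((params_finite hS e).inter_of_left _) ⟨0, zero_mem_params hV e, hlt⟩
  refine ⟨⟨e, r, t, hr.1, htr, ht.2.1⟩, ⟨hr.2.2, ht.2.2, fun x hx hx' hxS => ?_⟩, rfl, rfl⟩
  exact (hmax x ⟨⟨hr.1.trans hx.le, hx'.le.trans ht.2.1, hxS⟩, hx'⟩).not_gt hx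

theorem exists_segment_mem {S : Set G.Point} (hS : S.Finite) (hV : ∀ v, Point.vertex v ∈ S)
    {e : E} {t : ℝ} (h0 : 0 < t) (h1 : t < G.len e) (ht : G.pt e t ∉ S) :
    ∃ L, IsSegmentOf S L ∧ L.edge = e ∧ L.lo < t ∧ t < L.hi := by
  obtain ⟨r, ⟨hr, htr⟩, hmax⟩ := Set.exists_max_image (params S e ∩ Set.Iio t) id
    ((params_finite hS e).inter_of_left _) ⟨0, zero_mem_params hV e, h0⟩
  obtain ⟨L, hL, rfl, rfl⟩ := exists_segment_lo hS hV hr (lt_trans htr h1)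
  refine ⟨L, hL, rfl, htr, lt_of_not_ge fun hle => ?_⟩
  have hne : L.hi ≠ t := fun h => ht (h ▸ hL.2.1)
  exact (hmax L.hi ⟨⟨L.lo_nonneg.trans L.lo_lt_hi.le, L.hi_le, hL.2.1⟩,
    lt_of_le_of_ne hle hne⟩).not_gt L.lo_lt_hi

theorem IsSegmentOf.eq_of_lo {S : Set G.Point} {L L' : G.Segment} (h : IsSegmentOf S L)
    (h' : IsSegmentOf S L') (he : L.edge = L'.edge) (hlo : L.lo = L'.lo) : L = L' := by
  obtain ⟨e, lo, hi, h1, h2, h3⟩ := L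
  obtain ⟨e', lo', hi', h1', h2', h3'⟩ := L'
  obtain rfl : e = e' := he
  obtain rfl : lo = lo' := hlo
  obtain rfl : hi = hi' := by
    rcases lt_trichotomy hi hi' with hlt | heq | hgt
    · exact absurd h.2.1 (h'.2.2 hi h2 hlt)
    · exact heq
    · exact absurd h'.2.1 (h.2.2 hi' h2' hgt)
  rfl

theorem IsSegmentOf.eq_of_hi {S : Set G.Point} {L L' : G.Segment} (h : IsSegmentOf S L)
    (h' : IsSegmentOf S L') (he : L.edge = L'.edge) (hhi : L.hi = L'.hi) : L = L' := by
  refine h.eq_of_lo h' he ?_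
  obtain ⟨e, lo, hi, h1, h2, h3⟩ := L
  obtain ⟨e', lo', hi', h1', h2', h3'⟩ := L'
  obtain rfl : e = e' := he
  obtain rfl : hi = hi' := hhi
  rcases lt_trichotomy lo lo' with hlt | heq | hgt
  · exact absurd h'.1 (h.2.2 lo' hlt h2')
  · exact heq
  · exact absurd h.1 (h'.2.2 lo hgt h2)

theorem IsSegmentOf.eq_of_mem {S : Set G.Point} {L L' : G.Segment} (h : IsSegmentOf S L)
    (h' : IsSegmentOf S L') (he : L.edge = L'.edge) {t : ℝ} (ht : L.lo < t ∧ t < L.hi)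
    (ht' : L'.lo < t ∧ t < L'.hi) : L = L' := by
  refine h.eq_of_lo h' he ?_
  rcases lt_trichotomy L.lo L'.lo with hlt | heq | hgt
  · exact absurd (he ▸ h'.1) (h.2.2 _ hlt (ht'.1.trans ht.2))
  · exact heq
  · exact absurd (he ▸ h.1) (h'.2.2 _ hgt (ht.1.trans ht'.2))

theorem finite_isSegmentOf [Finite E] {S : Set G.Point} (hS : S.Finite) :
    {L : G.Segment | IsSegmentOf S L}.Finite := by
  have hfin : (⋃ e, (fun t => (e, t)) '' params S e : Set (E × ℝ)).Finite :=
    Set.finite_iUnion fun e => (params_finite hS e).image _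
  refine Set.Finite.of_finite_image (f := fun L => (L.edge, L.lo)) (hfin.subset ?_) ?_
  · rintro _ ⟨L, hL, rfl⟩
    exact Set.mem_iUnion.2 ⟨L.edge, L.lo, ⟨L.lo_nonneg, L.lo_lt_hi.le.trans L.hi_le, hL.1⟩, rfl⟩
  · intro L hL L' hL' h
    simp only [Prod.mk.injEq] at h
    exact IsSegmentOf.eq_of_lo hL hL' h.1 h.2

/-- The segments cut out by a finite set of points, as a finset. -/
noncomputable def segments [Finite E] (S : Finset G.Point) : Finset G.Segment :=
  (finite_isSegmentOf S.finite_toSet).toFinset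

theorem mem_segments [Finite E] {S : Finset G.Point} {L : G.Segment} :
    L ∈ segments S ↔ IsSegmentOf (S : Set G.Point) L := by
  simp [segments]

open Classical in
-- A segment has its lower end at a vertex only if `lo = 0`, so these segments correspond to the
-- edges with that source.
theorem sum_segments_lo [Fintype E] {M : Type*} [AddCommMonoid M] {S : Finset G.Point}
    (hV : ∀ v, Point.vertex v ∈ S) (F : E → ℝ → M) (v : V) :
    ∑ L ∈ segments S, (if G.pt L.edge L.lo = .vertex v then F L.edge L.lo else 0) =
      ∑ e, if G.src e = v then F e 0 else 0 := by
  rw [← Finset.sum_filter, ← Finset.sum_filter]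
  refine Finset.sum_bij (fun L _ => L.edge) ?_ ?_ ?_ ?_
  · intro L hL
    rw [Finset.mem_filter, pt_eq_vertex_iff_of_lt L.lo_nonneg (L.lo_lt_hi.trans_le L.hi_le)] at hL
    simp [hL.2.2]
  · intro L hL L' hL' h
    rw [Finset.mem_filter, pt_eq_vertex_iff_of_lt L.lo_nonneg (L.lo_lt_hi.trans_le L.hi_le)] at hL
    rw [Finset.mem_filter,
      pt_eq_vertex_iff_of_lt L'.lo_nonneg (L'.lo_lt_hi.trans_le L'.hi_le)] at hL'
    exact (mem_segments.1 hL.1).eq_of_lo (mem_segments.1 hL'.1) h (hL.2.1.trans hL'.2.1.symm)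
  · intro e he
    obtain ⟨L, hL, rfl, h0⟩ := exists_segment_lo S.finite_toSet hV
      (zero_mem_params (S := (S : Set G.Point)) hV e) (G.len_pos e)
    refine ⟨L, ?_, rfl⟩
    rw [Finset.mem_filter, pt_eq_vertex_iff_of_lt L.lo_nonneg (L.lo_lt_hi.trans_le L.hi_le)]
    exact ⟨mem_segments.2 hL, h0, by simpa using he⟩
  · intro L hL
    rw [Finset.mem_filter, pt_eq_vertex_iff_of_lt L.lo_nonneg (L.lo_lt_hi.trans_le L.hi_le)] at hL
    rw [hL.2.1]

open Classical in
theorem sum_segments_hi [Fintype E] {M : Type*} [AddCommMonoid M] {S : Finset G.Point}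
    (hV : ∀ v, Point.vertex v ∈ S) (F : E → ℝ → M) (v : V) :
    ∑ L ∈ segments S, (if G.pt L.edge L.hi = .vertex v then F L.edge L.hi else 0) =
      ∑ e, if G.tgt e = v then F e (G.len e) else 0 := by
  rw [← Finset.sum_filter, ← Finset.sum_filter]
  refine Finset.sum_bij (fun L _ => L.edge) ?_ ?_ ?_ ?_
  · intro L hL
    rw [Finset.mem_filter, pt_eq_vertex_iff_of_pos (L.lo_nonneg.trans_lt L.lo_lt_hi) L.hi_le] at hL
    simp [hL.2.2]
  · intro L hL L' hL' h
    rw [Finset.mem_filter, pt_eq_vertex_iff_of_pos (L.lo_nonneg.trans_lt L.lo_lt_hi) L.hi_le] at hL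
    rw [Finset.mem_filter,
      pt_eq_vertex_iff_of_pos (L'.lo_nonneg.trans_lt L'.lo_lt_hi) L'.hi_le] at hL'
    refine (mem_segments.1 hL.1).eq_of_hi (mem_segments.1 hL'.1) h ?_
    rw [hL.2.1, hL'.2.1, show L.edge = L'.edge from h]
  · intro e he
    obtain ⟨L, hL, rfl, h0⟩ := exists_segment_hi S.finite_toSet hV
      (len_mem_params (S := (S : Set G.Point)) hV e) (G.len_pos e)
    refine ⟨L, ?_, rfl⟩
    rw [Finset.mem_filter, pt_eq_vertex_iff_of_pos (L.lo_nonneg.trans_lt L.lo_lt_hi) L.hi_le]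
    exact ⟨mem_segments.2 hL, h0, by simpa using he⟩
  · intro L hL
    rw [Finset.mem_filter, pt_eq_vertex_iff_of_pos (L.lo_nonneg.trans_lt L.lo_lt_hi) L.hi_le] at hL
    rw [hL.2.1]

open Classical in
theorem sum_segments_lo_internal [Fintype E] {M : Type*} [AddCommMonoid M] {S : Finset G.Point}
    (hV : ∀ v, Point.vertex v ∈ S) (F : E → ℝ → M) {e : E} {t : ℝ} (h : 0 < t ∧ t < G.len e)
    (ht : Point.internal e t h ∈ S) :
    ∑ L ∈ segments S, (if G.pt L.edge L.lo = .internal e t h then F L.edge L.lo else 0) =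
      F e t := by
  obtain ⟨L, hL, rfl, rfl⟩ := exists_segment_lo S.finite_toSet hV
    (show t ∈ params (S : Set G.Point) e from
      ⟨h.1.le, h.2.le, by rw [pt_of_mem_Ioo h]; exact ht⟩) h.2
  rw [Finset.sum_eq_single_of_mem L (mem_segments.2 hL), if_pos (pt_of_mem_Ioo h)]
  intro L' hL' hne
  refine if_neg fun heq => hne ?_
  rw [pt_eq_internal_iff] at heq
  exact (mem_segments.1 hL').eq_of_lo hL heq.1 heq.2

open Classical in
theorem sum_segments_hi_internal [Fintype E] {M : Type*} [AddCommMonoid M] {S : Finset G.Point}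
    (hV : ∀ v, Point.vertex v ∈ S) (F : E → ℝ → M) {e : E} {t : ℝ} (h : 0 < t ∧ t < G.len e)
    (ht : Point.internal e t h ∈ S) :
    ∑ L ∈ segments S, (if G.pt L.edge L.hi = .internal e t h then F L.edge L.hi else 0) =
      F e t := by
  obtain ⟨L, hL, rfl, rfl⟩ := exists_segment_hi S.finite_toSet hV
    (show t ∈ params (S : Set G.Point) e from
      ⟨h.1.le, h.2.le, by rw [pt_of_mem_Ioo h]; exact ht⟩) h.1
  rw [Finset.sum_eq_single_of_mem L (mem_segments.2 hL), if_pos (pt_of_mem_Ioo h)]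
  intro L' hL' hne
  refine if_neg fun heq => hne ?_
  rw [pt_eq_internal_iff] at heq
  exact (mem_segments.1 hL').eq_of_hi hL heq.1 heq.2

open Classical in
-- This form treats vertices and internal points alike, and lets sums over points be exchanged with
-- sums over segments.
theorem ord_eq_sum_segments [Fintype E] {S : Finset G.Point} (hV : ∀ v, Point.vertex v ∈ S)
    (f : G.Point → ℝ) {p : G.Point} (hp : p ∈ S) :
    G.ord f p = ∑ L ∈ segments S,
      ((if G.pt L.edge L.lo = p then G.slopeFwd f L.edge L.lo else 0) +
        (if G.pt L.edge L.hi = p then G.slopeBwd f L.edge L.hi else 0)) := by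
  rw [Finset.sum_add_distrib]
  cases p with
  | vertex v =>
    rw [sum_segments_lo hV, sum_segments_hi hV, ← Finset.sum_add_distrib]
    rfl
  | internal e t h =>
    rw [sum_segments_lo_internal hV _ h hp, sum_segments_hi_internal hV _ h hp]
    rfl

/-- Segments are counted by lower ends: the vertices account for `Fintype.card E` of them, every
other point of `S` for exactly one. -/
theorem card_segments [Fintype V] [Fintype E] {S : Finset G.Point}
    (hV : ∀ v, Point.vertex v ∈ S) :
    (segments S).card + Fintype.card V = Fintype.card E + S.card := by
  classical
  let W : Finset G.Point := Finset.univ.image Point.vertex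
  have hWS : W ⊆ S := fun p hp => by
    obtain ⟨v, -, rfl⟩ := Finset.mem_image.1 hp
    exact hV v
  have hinj : Function.Injective (Point.vertex : V → G.Point) := fun v w h => by simpa using h
  have hW : W.card = Fintype.card V := Finset.card_image_of_injective _ hinj
  have h1 : (segments S).card =
      ∑ p ∈ S, ∑ L ∈ segments S, if G.pt L.edge L.lo = p then 1 else 0 := by
    rw [Finset.sum_comm, Finset.card_eq_sum_ones]
    refine Finset.sum_congr rfl fun L hL => ?_
    have : G.pt L.edge L.lo ∈ S := (mem_segments.1 hL).1
    simp [this]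
  have h2 : ∑ p ∈ W, ∑ L ∈ segments S, (if G.pt L.edge L.lo = p then 1 else 0) =
      Fintype.card E := by
    rw [Finset.sum_image hinj.injOn]
    simp only [sum_segments_lo hV (fun _ _ => 1)]
    rw [Finset.sum_comm]
    simp
  have h3 : ∑ p ∈ S \ W, ∑ L ∈ segments S, (if G.pt L.edge L.lo = p then 1 else 0) =
      (S \ W).card := by
    rw [Finset.card_eq_sum_ones]
    refine Finset.sum_congr rfl fun p hp => ?_
    rw [Finset.mem_sdiff] at hp
    cases p with
    | vertex v => exact absurd (Finset.mem_image_of_mem _ (Finset.mem_univ v)) hp.2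
    | internal e t h => exact sum_segments_lo_internal hV (fun _ _ => 1) h hp.1
  have h4 := Finset.card_sdiff_add_card_eq_card hWS
  rw [← Finset.sum_sdiff hWS, h2, h3] at h1
  omega

/-- No set of cut points other than the empty set and the whole is closed under adjacency. -/
theorem segments_connected {S : Set G.Point} (hS : S.Finite) (hV : ∀ v, Point.vertex v ∈ S)
    {A : Set G.Point} {p q : G.Point} (hp : p ∈ S) (hq : q ∈ S) (hpA : p ∈ A) (hqA : q ∉ A) :
    ∃ L, IsSegmentOf S L ∧ ((G.pt L.edge L.lo ∈ A ∧ G.pt L.edge L.hi ∉ A) ∨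
      (G.pt L.edge L.hi ∈ A ∧ G.pt L.edge L.lo ∉ A)) := by
  by_contra! hcon
  have hseg : ∀ L, IsSegmentOf S L → (G.pt L.edge L.lo ∈ A ↔ G.pt L.edge L.hi ∈ A) :=
    fun L hL => ⟨(hcon L hL).1, (hcon L hL).2⟩
  -- The least parameter violating the claim would be the upper end of a segment whose lower end
  -- satisfies it.
  have hedge : ∀ e, ∀ t ∈ params S e, (G.pt e t ∈ A ↔ Point.vertex (G.src e) ∈ A) := by
    intro e
    by_contra! hne
    obtain ⟨t₀, ht₀, hbad₀⟩ := hne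
    obtain ⟨t, ⟨ht, hbad⟩, hmin⟩ := Set.exists_min_image
      (params S e ∩ {t | ¬(G.pt e t ∈ A ↔ Point.vertex (G.src e) ∈ A)}) id
      ((params_finite hS e).inter_of_left _) ⟨t₀, ht₀, by
        show ¬ _
        tauto⟩
    have hpos : 0 < t := by
      refine lt_of_le_of_ne ht.1 ?_
      rintro rfl
      exact hbad (by rw [pt_zero])
    obtain ⟨L, hL, rfl, rfl⟩ := exists_segment_hi hS hV ht hpos
    refine (hmin L.lo ⟨⟨L.lo_nonneg, L.lo_lt_hi.le.trans L.hi_le, hL.1⟩, ?_⟩).not_gt L.lo_lt_hi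
    intro h
    exact hbad ((hseg L hL).symm.trans h)
  have hst : ∀ e, (Point.vertex (G.tgt e) ∈ A ↔ Point.vertex (G.src e) ∈ A) := fun e => by
    rw [← hedge e _ (len_mem_params hV e), pt_len]
  have hvert : ∀ u v : V, (Point.vertex u : G.Point) ∈ A ↔ Point.vertex v ∈ A := by
    intro u v
    induction G.connected u v with
    | refl => rfl
    | tail _ h ih =>
      obtain ⟨e, ⟨rfl, rfl⟩ | ⟨rfl, rfl⟩⟩ := h
      · rw [ih, hst]
      · rw [ih, hst]
  have hpt : ∀ r ∈ S, ∀ v, (r ∈ A ↔ Point.vertex v ∈ A) := by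
    intro r hr v
    cases r with
    | vertex u => exact hvert u v
    | internal e t h =>
      rw [← pt_of_mem_Ioo h] at hr ⊢
      rw [hedge e t ⟨h.1.le, h.2.le, hr⟩]
      exact hvert _ v
  obtain ⟨v⟩ := G.nonempty
  exact hqA ((hpt q hq v).2 ((hpt p hp v).1 hpA))

end MetricGraph

/-! ### Rational functions, linear equivalence, degree and rank -/

namespace MetricGraph

variable {V E : Type*} {G : MetricGraph V E}

theorem slopeFwd_eq {f : G.Point → ℝ} {e : E} {t t' c m : ℝ} (h : t < t')
    (hf : ∀ s ∈ Set.Icc t t', f (G.pt e s) = c + m * s) : G.slopeFwd f e t = m := by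
  have h1 : HasDerivWithinAt (fun s => c + m * s) m (Set.Ici t) t := by
    simpa using (((hasDerivAt_id t).const_mul m).const_add c).hasDerivWithinAt
  refine (h1.congr_of_eventuallyEq ?_ (hf t ⟨le_rfl, h.le⟩)).derivWithin (uniqueDiffWithinAt_Ici t)
  filter_upwards [Icc_mem_nhdsGE h] with s hs using hf s hs

theorem slopeBwd_eq {f : G.Point → ℝ} {e : E} {t t' c m : ℝ} (h : t' < t)
    (hf : ∀ s ∈ Set.Icc t' t, f (G.pt e s) = c + m * s) : G.slopeBwd f e t = -m := by
  have h1 : HasDerivWithinAt (fun s => c + m * s) m (Set.Iic t) t := by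
    simpa using (((hasDerivAt_id t).const_mul m).const_add c).hasDerivWithinAt
  refine congrArg Neg.neg
    ((h1.congr_of_eventuallyEq ?_ (hf t ⟨h.le, le_rfl⟩)).derivWithin (uniqueDiffWithinAt_Iic t))
  filter_upwards [Icc_mem_nhdsLE h] with s hs using hf s hs

theorem IsRational.exists_fwd {f : G.Point → ℝ} (hf : G.IsRational f) (e : E) {t : ℝ}
    (h0 : 0 ≤ t) (h1 : t < G.len e) :
    ∃ m : ℤ, ∃ c t', t < t' ∧ ∀ s ∈ Set.Icc t t', f (G.pt e s) = c + m * s := by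
  obtain ⟨B, hB⟩ := hf e
  obtain ⟨t', ⟨ht', htt'⟩, hmin⟩ := Set.exists_min_image
    (insert (G.len e) (B : Set ℝ) ∩ Set.Ioi t) id ((B.finite_toSet.insert _).inter_of_left _)
    ⟨G.len e, by simp, h1⟩
  have hle : t' ≤ G.len e := hmin (G.len e) ⟨by simp, h1⟩
  obtain ⟨m, hm⟩ := hB t t' h0 htt' hle fun s hs ⟨h, h'⟩ =>
    (hmin s ⟨.inr hs, h⟩).not_gt h'
  exact ⟨m, f (G.pt e t) - m * t, t', htt', fun s hs => by rw [hm s hs]; ring⟩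

theorem IsRational.exists_bwd {f : G.Point → ℝ} (hf : G.IsRational f) (e : E) {t : ℝ}
    (h0 : 0 < t) (h1 : t ≤ G.len e) :
    ∃ m : ℤ, ∃ c t', t' < t ∧ ∀ s ∈ Set.Icc t' t, f (G.pt e s) = c + m * s := by
  obtain ⟨B, hB⟩ := hf e
  obtain ⟨t', ⟨ht', htt'⟩, hmax⟩ := Set.exists_max_image
    (insert 0 (B : Set ℝ) ∩ Set.Iio t) id ((B.finite_toSet.insert _).inter_of_left _)
    ⟨0, by simp, h0⟩
  have hle : 0 ≤ t' := hmax 0 ⟨by simp, h0⟩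
  obtain ⟨m, hm⟩ := hB t' t hle htt' h1 fun s hs ⟨h, h'⟩ =>
    (hmax s ⟨.inr hs, h'⟩).not_gt h
  exact ⟨m, f (G.pt e t') - m * t', t', htt', fun s hs => by rw [hm s hs]; ring⟩

theorem IsRational.add {f g : G.Point → ℝ} (hf : G.IsRational f) (hg : G.IsRational g) :
    G.IsRational (f + g) := by
  classical
  intro e
  obtain ⟨B, hB⟩ := hf e
  obtain ⟨C, hC⟩ := hg e
  refine ⟨B ∪ C, fun x y h0 hxy h1 hs => ?_⟩
  obtain ⟨m, hm⟩ := hB x y h0 hxy h1 fun s h => hs s (Finset.mem_union_left _ h)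
  obtain ⟨n, hn⟩ := hC x y h0 hxy h1 fun s h => hs s (Finset.mem_union_right _ h)
  refine ⟨m + n, fun t ht => ?_⟩
  rw [Pi.add_apply, Pi.add_apply, hm t ht, hn t ht]
  push_cast
  ring

theorem IsRational.neg {f : G.Point → ℝ} (hf : G.IsRational f) : G.IsRational (-f) := by
  intro e
  obtain ⟨B, hB⟩ := hf e
  refine ⟨B, fun x y h0 hxy h1 hs => ?_⟩
  obtain ⟨m, hm⟩ := hB x y h0 hxy h1 hs
  refine ⟨-m, fun t ht => ?_⟩
  rw [Pi.neg_apply, Pi.neg_apply, hm t ht]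
  push_cast
  ring

theorem slopeFwd_add {f g : G.Point → ℝ} (hf : G.IsRational f) (hg : G.IsRational g) {e : E}
    {t : ℝ} (h0 : 0 ≤ t) (h1 : t < G.len e) :
    G.slopeFwd (f + g) e t = G.slopeFwd f e t + G.slopeFwd g e t := by
  obtain ⟨m, c, r, hr, h⟩ := hf.exists_fwd e h0 h1
  obtain ⟨n, d, q, hq, h'⟩ := hg.exists_fwd e h0 h1
  rw [slopeFwd_eq hr h, slopeFwd_eq hq h']
  refine slopeFwd_eq (c := c + d) (lt_min hr hq) fun s hs => ?_
  rw [Pi.add_apply, h s ⟨hs.1, hs.2.trans (min_le_left _ _)⟩,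
    h' s ⟨hs.1, hs.2.trans (min_le_right _ _)⟩]
  ring

theorem slopeBwd_add {f g : G.Point → ℝ} (hf : G.IsRational f) (hg : G.IsRational g) {e : E}
    {t : ℝ} (h0 : 0 < t) (h1 : t ≤ G.len e) :
    G.slopeBwd (f + g) e t = G.slopeBwd f e t + G.slopeBwd g e t := by
  obtain ⟨m, c, r, hr, h⟩ := hf.exists_bwd e h0 h1
  obtain ⟨n, d, q, hq, h'⟩ := hg.exists_bwd e h0 h1
  rw [slopeBwd_eq hr h, slopeBwd_eq hq h', ← neg_add]
  refine slopeBwd_eq (c := c + d) (max_lt hr hq) fun s hs => ?_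
  rw [Pi.add_apply, h s ⟨(le_max_left _ _).trans hs.1, hs.2⟩,
    h' s ⟨(le_max_right _ _).trans hs.1, hs.2⟩]
  ring

theorem ord_add [Fintype E] {f g : G.Point → ℝ} (hf : G.IsRational f) (hg : G.IsRational g)
    (p : G.Point) : G.ord (f + g) p = G.ord f p + G.ord g p := by
  classical
  cases p with
  | vertex v =>
    simp only [ord]
    rw [← Finset.sum_add_distrib]
    refine Finset.sum_congr rfl fun e _ => ?_
    rw [slopeFwd_add hf hg le_rfl (G.len_pos e), slopeBwd_add hf hg (G.len_pos e) le_rfl]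
    split_ifs <;> ring
  | internal e t h =>
    simp only [ord]
    rw [slopeFwd_add hf hg h.1.le h.2, slopeBwd_add hf hg h.1 h.2.le]
    ring

theorem ord_neg [Fintype E] (f : G.Point → ℝ) (p : G.Point) : G.ord (-f) p = -G.ord f p := by
  classical
  have h1 : ∀ e t, G.slopeFwd (-f) e t = -G.slopeFwd f e t := fun e t => derivWithin.fun_neg
  have h2 : ∀ e t, G.slopeBwd (-f) e t = -G.slopeBwd f e t := fun e t =>
    congrArg Neg.neg derivWithin.fun_neg
  cases p with
  | vertex v =>
    simp only [ord]
    rw [← Finset.sum_neg_distrib]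
    refine Finset.sum_congr rfl fun e _ => ?_
    rw [h1, h2]
    split_ifs <;> ring
  | internal e t h =>
    simp only [ord]
    rw [h1, h2]
    ring

theorem ord_pt [Fintype E] (f : G.Point → ℝ) {e : E} {t : ℝ} (h : 0 < t ∧ t < G.len e) :
    G.ord f (G.pt e t) = G.slopeFwd f e t + G.slopeBwd f e t := by
  rw [pt_of_mem_Ioo h]
  rfl

theorem linEquiv_add [Fintype E] {D₁ D₂ F₁ F₂ : G.Divisor} (h₁ : LinEquiv F₁ D₁)
    (h₂ : LinEquiv F₂ D₂) : LinEquiv (F₁ + F₂) (D₁ + D₂) := by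
  obtain ⟨f, hf, h⟩ := h₁
  obtain ⟨g, hg, h'⟩ := h₂
  refine ⟨f + g, hf.add hg, fun p => ?_⟩
  rw [ord_add hf hg, Finsupp.add_apply, Finsupp.add_apply]
  push_cast
  rw [h, h']
  ring

theorem linEquiv_symm [Fintype E] {D F : G.Divisor} (h : LinEquiv F D) : LinEquiv D F := by
  obtain ⟨f, hf, h⟩ := h
  exact ⟨-f, hf.neg, fun p => by rw [ord_neg, h]; ring⟩

theorem linEquiv_sub_left [Fintype E] {D F : G.Divisor} (h : LinEquiv F D) (N : G.Divisor) :
    LinEquiv (N - F) (N - D) := by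
  obtain ⟨f, hf, h⟩ := linEquiv_symm h
  exact ⟨f, hf, fun p => by
    rw [Finsupp.sub_apply, Finsupp.sub_apply]
    push_cast
    rw [h]
    ring⟩

/-- A rational function with nonnegative orders inside an interval is convex there, so its slopes
at the ends bound its mean slope. -/
theorem IsRational.slope_le_of_ord_nonneg [Fintype E] {f : G.Point → ℝ} (hf : G.IsRational f)
    (e : E) {x y : ℝ} (h0 : 0 ≤ x) (hxy : x < y) (h1 : y ≤ G.len e)
    (hord : ∀ t, x < t → t < y → 0 ≤ G.ord f (G.pt e t)) :
    ∃ m n : ℤ, G.slopeFwd f e x = m ∧ G.slopeBwd f e y = -n ∧ m ≤ n ∧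
      m * (y - x) ≤ f (G.pt e y) - f (G.pt e x) ∧
      f (G.pt e y) - f (G.pt e x) ≤ n * (y - x) := by
  classical
  obtain ⟨B, hB⟩ := hf e
  -- Induction on the number of break candidates inside the interval, splitting it at one of them.
  induction hk : (B.filter fun s => x < s ∧ s < y).card using Nat.strong_induction_on
    generalizing x y with
  | _ k ih =>
    by_cases hempty : ∃ s ∈ B, x < s ∧ s < y
    · obtain ⟨s, hsB, hxs, hsy⟩ := hempty
      have hlt : ∀ x' y', x ≤ x' → y' ≤ y → ¬(x' < s ∧ s < y') →
          (B.filter fun r => x' < r ∧ r < y').card < k := by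
        intro x' y' hx' hy' hns
        rw [← hk]
        refine Finset.card_lt_card ((Finset.ssubset_iff_of_subset ?_).2 ⟨s, ?_, ?_⟩)
        · intro r hr
          rw [Finset.mem_filter] at hr ⊢
          exact ⟨hr.1, hx'.trans_lt hr.2.1, hr.2.2.trans_le hy'⟩
        · exact Finset.mem_filter.2 ⟨hsB, hxs, hsy⟩
        · exact fun h => hns (Finset.mem_filter.1 h).2
      obtain ⟨m₁, n₁, hm₁, hn₁, hmn₁, hl₁, hu₁⟩ := ih _
        (hlt x s le_rfl hsy.le fun h => h.2.false) h0 hxs (hsy.le.trans h1)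
        (fun t h h' => hord t h (h'.trans hsy)) rfl
      obtain ⟨m₂, n₂, hm₂, hn₂, hmn₂, hl₂, hu₂⟩ := ih _
        (hlt s y hxs.le le_rfl fun h => h.1.false) (h0.trans hxs.le) hsy h1
        (fun t h h' => hord t (hxs.trans h) h') rfl
      have hs := hord s hxs hsy
      rw [ord_pt f ⟨h0.trans_lt hxs, hsy.trans_le h1⟩, hm₂, hn₁] at hs
      -- The order at `s` is `m₂ - n₁`: nonnegativity says that the slope does not drop at `s`.
      have hle : n₁ ≤ m₂ := by
        have : (n₁ : ℝ) ≤ m₂ := by linarith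
        exact_mod_cast this
      have c1 : (m₁ : ℝ) ≤ m₂ := by exact_mod_cast hmn₁.trans hle
      have c2 : (n₁ : ℝ) ≤ n₂ := by exact_mod_cast hle.trans hmn₂
      refine ⟨m₁, n₂, hm₁, hn₂, hmn₁.trans (hle.trans hmn₂), ?_, ?_⟩
      · nlinarith [mul_le_mul_of_nonneg_right c1 (sub_nonneg.2 hsy.le)]
      · nlinarith [mul_le_mul_of_nonneg_right c2 (sub_nonneg.2 hxs.le)]
    · push Not at hempty
      obtain ⟨m, hm⟩ := hB x y h0 hxy h1 fun s hs ⟨h, h'⟩ => (hempty s hs h).not_gt h'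
      have hlin : ∀ t ∈ Set.Icc x y, f (G.pt e t) = (f (G.pt e x) - m * x) + m * t :=
        fun t ht => by rw [hm t ht]; ring
      have hy := hm y ⟨hxy.le, le_rfl⟩
      exact ⟨m, m, slopeFwd_eq hxy hlin, slopeBwd_eq hxy hlin, le_rfl, by linarith, by linarith⟩

theorem deg_eq_sum {D : G.Divisor} {S : Finset G.Point} (h : D.support ⊆ S) :
    deg D = ∑ p ∈ S, D p :=
  Finset.sum_subset h fun p _ hp => by simpa using hp

/-- Linearly equivalent divisors have the same degree. -/
theorem deg_eq_of_linEquiv [Fintype V] [Fintype E] {D D' : G.Divisor} (h : LinEquiv D D') :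
    deg D = deg D' := by
  classical
  obtain ⟨f, hf, hD⟩ := h
  choose B hB using hf
  -- Cutting at all break candidates makes `f` linear on each segment, whose two ends then
  -- contribute opposite slopes.
  let S : Finset G.Point := D.support ∪ D'.support ∪ Finset.univ.image Point.vertex ∪
    Finset.univ.biUnion fun e => (B e).image (G.pt e)
  have hV : ∀ v, Point.vertex v ∈ S := fun v => by simp [S]
  have hsub : D.support ⊆ S := fun p hp => by
    simp only [S, Finset.mem_union]; tauto
  have hsub' : D'.support ⊆ S := fun p hp => by
    simp only [S, Finset.mem_union]; tauto
  have hsum : ∑ p ∈ S, G.ord f p = 0 := by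
    rw [Finset.sum_congr rfl fun p hp => ord_eq_sum_segments hV f hp, Finset.sum_comm]
    refine Finset.sum_eq_zero fun L hL => ?_
    have hL := mem_segments.1 hL
    rw [Finset.sum_add_distrib, Finset.sum_ite_eq, Finset.sum_ite_eq, if_pos (Finset.mem_coe.1 hL.1),
      if_pos (Finset.mem_coe.1 hL.2.1)]
    obtain ⟨m, hm⟩ := hB L.edge L.lo L.hi L.lo_nonneg L.lo_lt_hi L.hi_le fun s hs ⟨h, h'⟩ => by
      refine hL.2.2 s h h' ?_
      simp only [S, Finset.coe_union, Set.mem_union, Finset.mem_coe, Finset.mem_biUnion,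
        Finset.mem_image]
      exact .inr ⟨L.edge, Finset.mem_univ _, s, hs, rfl⟩
    have hlin : ∀ t ∈ Set.Icc L.lo L.hi,
        f (G.pt L.edge t) = (f (G.pt L.edge L.lo) - m * L.lo) + m * t :=
      fun t ht => by rw [hm t ht]; ring
    rw [slopeFwd_eq L.lo_lt_hi hlin, slopeBwd_eq L.lo_lt_hi hlin, add_neg_cancel]
  have : (deg D : ℝ) = deg D' := by
    rw [deg_eq_sum hsub, deg_eq_sum hsub']
    push_cast
    rw [Finset.sum_congr rfl fun p _ => hD p, Finset.sum_add_distrib, hsum, add_zero]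
  exact_mod_cast this

theorem deg_nonneg {F : G.Divisor} (h : 0 ≤ F) : 0 ≤ deg F :=
  Finset.sum_nonneg fun p _ => h p

/-- The zero divisor is the only effective divisor of degree zero, so the rank is negative exactly
when it competes in the minimum. -/
theorem rank_nonneg_iff [Fintype E] (D : G.Divisor) :
    0 ≤ rank D ↔ (linearSystem D).Nonempty := by
  have hbdd : BddBelow {n : ℤ | ∃ F : G.Divisor, 0 ≤ F ∧ linearSystem (D - F) = ∅ ∧
      n = deg F - 1} := ⟨-1, by
    rintro n ⟨F, hF, -, rfl⟩
    have := deg_nonneg hF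
    linarith⟩
  constructor
  · intro h
    by_contra hne
    rw [Set.not_nonempty_iff_eq_empty] at hne
    have : rank D ≤ -1 := csInf_le hbdd ⟨0, le_rfl, by rwa [sub_zero], by simp [deg]⟩
    omega
  · rintro ⟨F₀, hF₀⟩
    unfold rank
    rcases Set.eq_empty_or_nonempty {n : ℤ | ∃ F : G.Divisor, 0 ≤ F ∧
      linearSystem (D - F) = ∅ ∧ n = deg F - 1} with he | hne
    -- The infimum of the empty set of integers is `0` by convention, which agrees with the claim.
    · rw [he, Int.csInf_empty]
    · obtain ⟨F, hF, hem, hn⟩ := Int.csInf_mem hne hbdd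
      rw [hn]
      have h0 : deg F ≠ 0 := by
        intro h0
        have hz : F = 0 := by
          ext p
          by_cases hp : p ∈ F.support
          · exact (Finset.sum_eq_zero_iff_of_nonneg (fun p _ => hF p)).1 h0 p hp
          · simpa using hp
        rw [hz, sub_zero] at hem
        rw [hem] at hF₀
        exact hF₀
      have := deg_nonneg hF
      omega

theorem eq_of_le_of_deg_eq {D D' : G.Divisor} (h : 0 ≤ D' - D) (hd : deg D = deg D') :
    D = D' := by
  classical
  have h1 := deg_eq_sum (D := D) (S := D.support ∪ D'.support) Finset.subset_union_left
  have h2 := deg_eq_sum (D := D') (S := D.support ∪ D'.support) Finset.subset_union_right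
  have hle : ∀ p, D p ≤ D' p := fun p => by
    have := h p
    rw [Finsupp.sub_apply] at this
    simpa using this
  ext p
  by_cases hp : p ∈ D.support ∪ D'.support
  · exact (Finset.sum_eq_sum_iff_of_le fun p _ => hle p).1 (by omega) p hp
  · simp only [Finset.mem_union, Finsupp.mem_support_iff] at hp
    push Not at hp
    rw [hp.1, hp.2]

/-! ### The divisor of a permutation -/

namespace Permutation

variable {I : Set G.Point} (P : G.Permutation I)

open Classical in
/-- The support of a permutation. -/
noncomputable def supp : Finset G.Point := P.toList.toFinset

variable {P}

theorem mem_supp {p : G.Point} : p ∈ P.supp ↔ p ∈ P.toList := by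
  simp [supp]

theorem isPSegment_iff {L : G.Segment} :
    P.IsPSegment L ↔ IsSegmentOf (P.supp : Set G.Point) L := by
  simp [IsPSegment, IsSegmentOf, mem_supp]

theorem vertex_mem_supp (v : V) : Point.vertex v ∈ P.supp :=
  mem_supp.2 (P.vertex_mem v)

theorem nu_apply_of_mem {p : G.Point} (hp : p ∈ P.toList) :
    P.nu p = ((P.segs p).ncard : ℤ) - 1 := by
  classical
  simp only [nu, Finsupp.coe_finsetSum, Finset.sum_apply, Finsupp.single_apply]
  rw [Finset.sum_ite_eq', if_pos (List.mem_toFinset.2 hp)]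

theorem nu_apply_of_notMem {p : G.Point} (hp : p ∉ P.toList) : P.nu p = 0 := by
  classical
  simp only [nu, Finsupp.coe_finsetSum, Finset.sum_apply, Finsupp.single_apply]
  rw [Finset.sum_ite_eq', if_neg (by rwa [List.mem_toFinset])]

theorem segs_subset [Finite E] (p : G.Point) : P.segs p ⊆ segments P.supp := fun _ hL =>
  Finset.mem_coe.2 (mem_segments.2 (isPSegment_iff.1 hL.1))

open Classical in
theorem ncard_segs_eq_card [Finite E] (p : G.Point) :
    (P.segs p).ncard = ((segments P.supp).filter fun L => L ∈ P.segs p).card := by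
  rw [← Set.ncard_coe_finset]
  congr 1
  ext L
  simp only [Finset.coe_filter, Set.mem_ofPred_eq]
  exact ⟨fun h => ⟨by simpa using segs_subset p h, h⟩, fun h => h.2⟩

open Classical in
theorem precedes_total {p q : G.Point} (hp : p ∈ P.toList) (hq : q ∈ P.toList) (hne : p ≠ q) :
    P.Precedes p q ∨ P.Precedes q p := by
  have : P.toList.idxOf p ≠ P.toList.idxOf q := fun h => hne ((List.idxOf_inj hp).1 h)
  rcases lt_or_gt_of_ne this with h | h
  · exact .inl ⟨hp, hq, h⟩
  · exact .inr ⟨hq, hp, h⟩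

theorem Precedes.asymm {p q : G.Point} (h : P.Precedes p q) : ¬P.Precedes q p :=
  fun h' => (h.2.2.trans h'.2.2).false

/-- Coinciding ends would force the segment to be a whole loop, but the point of `I` inside that
loop cuts it. This is the role of the loop transversal. -/
theorem isPSegment_ends_ne (hI : G.IsLoopTransversal I) {L : G.Segment} (hL : P.IsPSegment L) :
    G.pt L.edge L.lo ≠ G.pt L.edge L.hi := by
  intro h
  rcases L.lo_nonneg.eq_or_lt with h0 | h0
  · rw [← h0, pt_zero, eq_comm, pt_eq_vertex_iff_of_pos (L.lo_nonneg.trans_lt L.lo_lt_hi) L.hi_le]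
      at h
    obtain ⟨p, ⟨hpI, t, ht, rfl⟩, -⟩ := hI.2 L.edge h.2.symm
    refine hL.2.2 t (h0 ▸ ht.1) (h.1 ▸ ht.2) ?_
    rw [pt_of_mem_Ioo ht]
    exact P.transversal_mem _ hpI
  · rw [pt_of_mem_Ioo ⟨h0, L.lo_lt_hi.trans_le L.hi_le⟩, eq_comm, pt_eq_internal_iff] at h
    exact L.lo_lt_hi.ne' h.2

/-- Each segment has distinct ends and is counted once, at the later one; `card_segments` then gives
`|E| - |V|`. -/
theorem deg_nu [Fintype V] [Fintype E] (hI : G.IsLoopTransversal I) :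
    deg P.nu = G.genus - 1 := by
  classical
  have hsupp : P.nu.support ⊆ P.supp := fun p hp => by
    by_contra h
    rw [mem_supp] at h
    exact Finsupp.mem_support_iff.1 hp (nu_apply_of_notMem h)
  have hcount : ∑ p ∈ P.supp, (P.segs p).ncard = (segments P.supp).card := by
    simp only [ncard_segs_eq_card, Finset.card_filter]
    rw [Finset.sum_comm, Finset.card_eq_sum_ones]
    refine Finset.sum_congr rfl fun L hL => ?_
    rw [mem_segments, ← isPSegment_iff] at hL
    rcases precedes_total hL.1 hL.2.1 (isPSegment_ends_ne hI hL) with h | h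
    · rw [Finset.sum_eq_single_of_mem _ (mem_supp.2 hL.2.1),
        if_pos ⟨hL, .inr ⟨rfl, h⟩⟩]
      refine fun p _ hne => if_neg fun hp => ?_
      rcases hp.2 with ⟨rfl, h'⟩ | ⟨rfl, h'⟩
      exacts [h.asymm h', hne rfl]
    · rw [Finset.sum_eq_single_of_mem _ (mem_supp.2 hL.1),
        if_pos ⟨hL, .inl ⟨rfl, h⟩⟩]
      refine fun p _ hne => if_neg fun hp => ?_
      rcases hp.2 with ⟨rfl, h'⟩ | ⟨rfl, h'⟩
      exacts [hne rfl, h.asymm h']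
  have hcard := card_segments (S := P.supp) vertex_mem_supp
  rw [deg_eq_sum hsupp, Finset.sum_congr rfl fun p hp => nu_apply_of_mem (mem_supp.1 hp),
    Finset.sum_sub_distrib, ← Nat.cast_sum, hcount]
  simp only [Finset.sum_const, nsmul_eq_mul, mul_one, genus]
  omega

/-- The divisor of a permutation is not equivalent to an effective one: at the earliest of the
points of the support where a rational function is maximal, the sum is negative. -/
theorem linearSystem_nu_eq_empty [Fintype E] : linearSystem P.nu = ∅ := by
  classical
  rw [Set.eq_empty_iff_forall_notMem]
  rintro F ⟨hF, f, hf, hord⟩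
  have hne : P.supp.Nonempty := by
    obtain ⟨v⟩ := G.nonempty
    exact ⟨_, vertex_mem_supp v⟩
  obtain ⟨p₀, hp₀, hmax₀⟩ := Finset.exists_max_image P.supp f hne
  -- Being the earliest maximizer, `p` has strictly larger value than each of its predecessors.
  obtain ⟨p, hp, hfirst⟩ := Finset.exists_min_image (P.supp.filter fun q => f q = f p₀)
    (fun q => P.toList.idxOf q) ⟨p₀, by simp [hp₀]⟩
  rw [Finset.mem_filter] at hp
  have hmax : ∀ q ∈ P.supp, f q ≤ f p := fun q hq => (hmax₀ q hq).trans hp.2.ge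
  have hstrict : ∀ q, P.Precedes q p → f q < f p := fun q hq =>
    lt_of_le_of_ne (hmax q (mem_supp.2 hq.1)) fun h =>
      (hfirst q (Finset.mem_filter.2 ⟨mem_supp.2 hq.1, h.trans hp.2⟩)).not_gt hq.2.2
  have hbound : G.ord f p ≤ -((P.segs p).ncard : ℝ) := by
    rw [ord_eq_sum_segments vertex_mem_supp f hp.1, ncard_segs_eq_card, Finset.card_filter]
    push_cast
    rw [← Finset.sum_neg_distrib]
    refine Finset.sum_le_sum fun L hL => ?_
    have hL := mem_segments.1 hL
    -- `nu` vanishes inside the segment, so `f` is convex there and its end slopes compare with the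
    -- mean slope; integrality improves strict negativity to `-1`.
    obtain ⟨m, n, hm, hn, -, hlo, hhi⟩ := hf.slope_le_of_ord_nonneg L.edge L.lo_nonneg
      L.lo_lt_hi L.hi_le fun t h h' => by
        have h1 := hord (G.pt L.edge t)
        rw [nu_apply_of_notMem (fun h2 => hL.2.2 t h h' (by simpa [mem_supp] using h2))] at h1
        have h2 : (0 : ℝ) ≤ F (G.pt L.edge t) := by exact_mod_cast hF (G.pt L.edge t)
        push_cast at h1
        linarith
    have hℓ := sub_pos.2 L.lo_lt_hi
    have hmle : G.pt L.edge L.lo = p → m ≤ 0 := fun h => by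
      have := hmax _ hL.2.1
      rw [← h] at this
      have : (m : ℝ) * (L.hi - L.lo) ≤ 0 := by linarith
      exact_mod_cast nonpos_of_mul_nonpos_left this hℓ
    have hnle : G.pt L.edge L.hi = p → 0 ≤ n := fun h => by
      have := hmax _ hL.1
      rw [← h] at this
      have : 0 ≤ (n : ℝ) * (L.hi - L.lo) := by linarith
      exact_mod_cast nonneg_of_mul_nonneg_left this hℓ
    have hmlt : G.pt L.edge L.lo = p → P.Precedes (G.pt L.edge L.hi) p → m ≤ -1 := fun h h' => by
      have := hstrict _ h'
      rw [← h] at this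
      have : (m : ℝ) * (L.hi - L.lo) < 0 := by linarith
      have : m < 0 := by exact_mod_cast neg_of_mul_neg_left this hℓ.le
      omega
    have hnlt : G.pt L.edge L.hi = p → P.Precedes (G.pt L.edge L.lo) p → 1 ≤ n := fun h h' => by
      have := hstrict _ h'
      rw [← h] at this
      have : 0 < (n : ℝ) * (L.hi - L.lo) := by linarith
      have : 0 < n := by exact_mod_cast pos_of_mul_pos_left this hℓ.le
      omega
    rw [hm, hn]
    have key : ((if G.pt L.edge L.lo = p then m else 0) +
        (if G.pt L.edge L.hi = p then -n else 0)) ≤ -(if L ∈ P.segs p then 1 else 0) := by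
      by_cases hs : L ∈ P.segs p
      · rw [if_pos hs]
        rcases hs.2 with ⟨h, h'⟩ | ⟨h, h'⟩
        · have := hmlt h h'
          rw [if_pos h]
          split_ifs with h''
          · have := hnle h''
            omega
          · omega
        · have := hnlt h h'
          rw [if_pos h]
          split_ifs with h''
          · have := hmle h''
            omega
          · omega
      · rw [if_neg hs]
        split_ifs with h h' h'
        · have := hmle h
          have := hnle h'
          omega
        · have := hmle h
          omega
        · have := hnle h'
          omega
        · omega
    exact_mod_cast key
  have h1 := hord p
  rw [nu_apply_of_mem (mem_supp.1 hp.1)] at h1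
  have h2 : (0 : ℝ) ≤ F p := by exact_mod_cast hF p
  push_cast at h1
  linarith

end Permutation

end MetricGraph

theorem idxOf_map_of_injective {α β : Type*} [BEq α] [LawfulBEq α] [BEq β]
    [LawfulBEq β] {f : α → β}
    (hf : Function.Injective f) (l : List α) (x : α) :
    (l.map f).idxOf (f x) = l.idxOf x := by
  induction l with
  | nil => rfl
  | cons y l ih =>
    rw [List.map_cons, List.idxOf_cons, List.idxOf_cons, ih]
    by_cases h : y = x
    · rw [beq_iff_eq.2 h, beq_iff_eq.2 (congrArg f h)]
    · rw [beq_eq_false_iff_ne.2 h, beq_eq_false_iff_ne.2 (hf.ne h)]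

/-! ### Integral convex interpolation of a potential -/

namespace MetricGraph

variable {V E : Type*} {G : MetricGraph V E}

namespace Segment

/-- The mean slope on a segment of a function with values `u` at its ends. -/
noncomputable def slope (L : G.Segment) (u : G.Point → ℝ) : ℝ :=
  (u (G.pt L.edge L.hi) - u (G.pt L.edge L.lo)) / (L.hi - L.lo)

/-- The parameter at which the integral slope has to jump from `⌊q⌋` to `⌊q⌋ + 1` in order to
achieve the mean slope `q`; it is the upper end when `q` is an integer. -/
noncomputable def bend (L : G.Segment) (u : G.Point → ℝ) : ℝ :=
  L.hi - (L.hi - L.lo) * Int.fract (L.slope u)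

open Classical in
/-- The convex function with slopes `⌊q⌋` and `⌊q⌋ + 1` and values `u` at the ends. -/
noncomputable def interpolation (L : G.Segment) (u : G.Point → ℝ) (t : ℝ) : ℝ :=
  if t ≤ L.bend u then u (G.pt L.edge L.lo) + ⌊L.slope u⌋ * (t - L.lo)
  else u (G.pt L.edge L.hi) - (⌊L.slope u⌋ + 1) * (L.hi - t)

variable (L : G.Segment) (u : G.Point → ℝ)

theorem lo_lt_bend : L.lo < L.bend u := by
  have := mul_lt_mul_of_pos_left (Int.fract_lt_one (L.slope u)) (sub_pos.2 L.lo_lt_hi)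
  unfold Segment.bend
  linarith

theorem bend_le_hi : L.bend u ≤ L.hi := by
  have := mul_nonneg (sub_pos.2 L.lo_lt_hi).le (Int.fract_nonneg (L.slope u))
  unfold Segment.bend
  linarith

theorem bend_eq_hi_iff : L.bend u = L.hi ↔
    ∃ k : ℤ, u (G.pt L.edge L.hi) - u (G.pt L.edge L.lo) = k * (L.hi - L.lo) := by
  have hℓ := (sub_pos.2 L.lo_lt_hi).ne'
  have h1 : L.bend u = L.hi ↔ Int.fract (L.slope u) = 0 := by
    unfold Segment.bend
    rw [sub_eq_self, mul_eq_zero]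
    tauto
  rw [h1, Int.fract_eq_zero_iff, Set.mem_range]
  unfold Segment.slope
  exact exists_congr fun k => by rw [eq_div_iff hℓ, eq_comm]

theorem slope_mul : L.slope u * (L.hi - L.lo) =
    u (G.pt L.edge L.hi) - u (G.pt L.edge L.lo) :=
  div_mul_cancel₀ _ (sub_pos.2 L.lo_lt_hi).ne'

theorem interpolation_of_le {t : ℝ} (ht : t ≤ L.bend u) : L.interpolation u t =
    (u (G.pt L.edge L.lo) - ⌊L.slope u⌋ * L.lo) + (⌊L.slope u⌋ : ℤ) * t := by
  rw [interpolation, if_pos ht]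
  ring

theorem interpolation_of_ge {t : ℝ} (ht : L.bend u ≤ t) : L.interpolation u t =
    (u (G.pt L.edge L.hi) - (⌊L.slope u⌋ + 1) * L.hi) + ((⌊L.slope u⌋ + 1 : ℤ) : ℝ) * t := by
  rcases ht.eq_or_lt with rfl | h
  · rw [interpolation_of_le L u le_rfl]
    have h1 := L.slope_mul u
    have h2 := Int.floor_add_fract (L.slope u)
    unfold Segment.bend
    push_cast
    rw [show u (G.pt L.edge L.hi) = u (G.pt L.edge L.lo) + L.slope u * (L.hi - L.lo) by
      linarith, ← h2]
    simp only [Int.floor_intCast_add, Int.floor_fract, Int.fract_intCast_add, Int.fract_fract,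
      add_zero]
    ring
  · rw [interpolation, if_neg h.not_ge]
    push_cast
    ring

theorem interpolation_lo : L.interpolation u L.lo = u (G.pt L.edge L.lo) := by
  rw [interpolation_of_le L u (L.lo_lt_bend u).le]
  ring

theorem interpolation_hi : L.interpolation u L.hi = u (G.pt L.edge L.hi) := by
  rw [interpolation_of_ge L u (L.bend_le_hi u)]
  push_cast
  ring

theorem param_mem_Ioo {t : ℝ} (h : L.lo < t ∧ t < L.hi) : 0 < t ∧ t < G.len L.edge :=
  ⟨L.lo_nonneg.trans_lt h.1, h.2.trans_le L.hi_le⟩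

end Segment

theorem IsSegmentOf.eq_of_pt_eq {S : Set G.Point} {L L' : G.Segment} (h : IsSegmentOf S L)
    (h' : IsSegmentOf S L') {t t' : ℝ} (ht : L.lo < t ∧ t < L.hi)
    (ht' : L'.lo < t' ∧ t' < L'.hi) (heq : G.pt L.edge t = G.pt L'.edge t') :
    L = L' ∧ t = t' := by
  rw [pt_of_mem_Ioo (L'.param_mem_Ioo ht'), pt_eq_internal_iff] at heq
  obtain ⟨he, rfl⟩ := heq
  exact ⟨h.eq_of_mem h' he ht ht', rfl⟩

/-- `f` interpolates `u` on the segments cut out by `S`. -/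
def Interpolates (S : Set G.Point) (u f : G.Point → ℝ) : Prop :=
  ∀ L, IsSegmentOf S L → ∀ t ∈ Set.Icc L.lo L.hi, f (G.pt L.edge t) = L.interpolation u t

/-- A point outside `S` is interior to at most one segment, at one parameter, so the choice is
harmless; the value `0` only serves points that no segment covers. -/
theorem exists_interpolates (S : Set G.Point) (u : G.Point → ℝ) : ∃ f, Interpolates S u f := by
  classical
  let Q : G.Point → G.Segment × ℝ → Prop := fun p x =>
    IsSegmentOf S x.1 ∧ (x.1.lo < x.2 ∧ x.2 < x.1.hi) ∧ G.pt x.1.edge x.2 = p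
  refine ⟨fun p => if p ∈ S then u p else
    if h : ∃ x, Q p x then h.choose.1.interpolation u h.choose.2 else 0, fun L hL t ht => ?_⟩
  rcases ht.1.eq_or_lt with rfl | h1
  · simp only [if_pos hL.1, L.interpolation_lo]
  rcases ht.2.eq_or_lt with rfl | h2
  · simp only [if_pos hL.2.1, L.interpolation_hi]
  have h : ∃ x, Q (G.pt L.edge t) x := ⟨(L, t), hL, ⟨h1, h2⟩, rfl⟩
  simp only [if_neg (hL.2.2 t h1 h2), dif_pos h]
  obtain ⟨h3, h4, h5⟩ := h.choose_spec
  obtain ⟨h6, h7⟩ := h3.eq_of_pt_eq hL h4 ⟨h1, h2⟩ h5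
  rw [h6, h7]

namespace Interpolates

variable {S : Set G.Point} {u f : G.Point → ℝ} {L : G.Segment}

theorem slopeFwd_of_lt (hf : Interpolates S u f) (hL : IsSegmentOf S L) {t : ℝ}
    (h : L.lo ≤ t) (h' : t < L.bend u) : G.slopeFwd f L.edge t = ⌊L.slope u⌋ :=
  slopeFwd_eq h' fun s hs => by
    rw [hf L hL s ⟨h.trans hs.1, hs.2.trans (L.bend_le_hi u)⟩, L.interpolation_of_le u hs.2]

theorem slopeFwd_of_ge (hf : Interpolates S u f) (hL : IsSegmentOf S L) {t : ℝ}
    (h : L.bend u ≤ t) (h' : t < L.hi) : G.slopeFwd f L.edge t = (⌊L.slope u⌋ + 1 : ℤ) :=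
  slopeFwd_eq h' fun s hs => by
    rw [hf L hL s ⟨((L.lo_lt_bend u).le.trans h).trans hs.1, hs.2⟩,
      L.interpolation_of_ge u (h.trans hs.1)]

theorem slopeBwd_of_le (hf : Interpolates S u f) (hL : IsSegmentOf S L) {t : ℝ}
    (h : L.lo < t) (h' : t ≤ L.bend u) : G.slopeBwd f L.edge t = -⌊L.slope u⌋ :=
  slopeBwd_eq h fun s hs => by
    rw [hf L hL s ⟨hs.1, (hs.2.trans h').trans (L.bend_le_hi u)⟩,
      L.interpolation_of_le u (hs.2.trans h')]

theorem slopeBwd_of_gt (hf : Interpolates S u f) (hL : IsSegmentOf S L) {t : ℝ}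
    (h : L.bend u < t) (h' : t ≤ L.hi) : G.slopeBwd f L.edge t = -(⌊L.slope u⌋ + 1 : ℤ) :=
  slopeBwd_eq h fun s hs => by
    rw [hf L hL s ⟨(L.lo_lt_bend u).le.trans hs.1, hs.2.trans h'⟩,
      L.interpolation_of_ge u hs.1]

theorem slopeFwd_lo (hf : Interpolates S u f) (hL : IsSegmentOf S L) :
    G.slopeFwd f L.edge L.lo =
      ⌊(u (G.pt L.edge L.hi) - u (G.pt L.edge L.lo)) / (L.hi - L.lo)⌋ :=
  hf.slopeFwd_of_lt hL le_rfl (L.lo_lt_bend u)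

/-- The last slope is `⌈q⌉` for the mean slope `q`, bend or not, and `-⌈q⌉ = ⌊-q⌋`. Thus outgoing
slopes are rounded down at both ends, as in `floorLaplacian`. -/
theorem slopeBwd_hi (hf : Interpolates S u f) (hL : IsSegmentOf S L) :
    G.slopeBwd f L.edge L.hi =
      ⌊(u (G.pt L.edge L.lo) - u (G.pt L.edge L.hi)) / (L.hi - L.lo)⌋ := by
  have hneg : (u (G.pt L.edge L.lo) - u (G.pt L.edge L.hi)) / (L.hi - L.lo) = -L.slope u := by
    rw [Segment.slope, ← neg_div, neg_sub]
  have h1 := Int.floor_add_fract (L.slope u)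
  have hℓ := sub_pos.2 L.lo_lt_hi
  rw [hneg]
  rcases (L.bend_le_hi u).eq_or_lt with h | h
  · rw [hf.slopeBwd_of_le hL L.lo_lt_hi h.ge]
    have h2 : Int.fract (L.slope u) = 0 := by
      rw [Segment.bend, sub_eq_self, mul_eq_zero] at h
      exact h.resolve_left hℓ.ne'
    rw [h2, add_zero] at h1
    rw [← h1]
    simp [← Int.cast_neg, Int.floor_intCast]
  · rw [hf.slopeBwd_of_gt hL h le_rfl, ← Int.cast_neg]
    congr 1
    have h2 : 0 < Int.fract (L.slope u) := by
      rw [Segment.bend, sub_lt_self_iff] at h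
      exact pos_of_mul_pos_right h hℓ.le
    have h3 := Int.fract_lt_one (L.slope u)
    rw [eq_comm, Int.floor_eq_iff]
    push_cast
    constructor <;> linarith

theorem isRational [Finite E] (hf : Interpolates S u f) (hS : S.Finite)
    (hV : ∀ v, Point.vertex v ∈ S) : G.IsRational f := by
  classical
  intro e
  refine ⟨(params_finite hS e).toFinset ∪
    (finite_isSegmentOf hS).toFinset.image (fun L => L.bend u), fun x y h0 hxy h1 hs => ?_⟩
  have hpar : ∀ t ∈ params S e, ¬(x < t ∧ t < y) := fun t ht =>
    hs t (Finset.mem_union_left _ (by simpa using ht))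
  have hbrk : ∀ L, IsSegmentOf S L → ¬(x < L.bend u ∧ L.bend u < y) := fun L hL =>
    hs _ (Finset.mem_union_right _ (Finset.mem_image_of_mem _ (by simpa using hL)))
  -- The midpoint identifies the segment that contains the whole interval.
  have hc : x < (x + y) / 2 ∧ (x + y) / 2 < y := by constructor <;> linarith
  obtain ⟨L, hL, rfl, hlo, hhi⟩ := exists_segment_mem hS hV (h0.trans_lt hc.1)
    (hc.2.trans_le h1) (fun h => hpar _ ⟨(h0.trans_lt hc.1).le, (hc.2.trans_le h1).le, h⟩ hc)
  have hlx : L.lo ≤ x := not_lt.1 fun h => hpar L.lo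
    ⟨L.lo_nonneg, L.lo_lt_hi.le.trans L.hi_le, hL.1⟩ ⟨h, hlo.trans hc.2⟩
  have hyh : y ≤ L.hi := not_lt.1 fun h => hpar L.hi
    ⟨L.lo_nonneg.trans L.lo_lt_hi.le, L.hi_le, hL.2.1⟩ ⟨hc.1.trans hhi, h⟩
  rcases lt_or_ge x (L.bend u) with h | h
  · have hy : y ≤ L.bend u := not_lt.1 fun h' => hbrk L hL ⟨h, h'⟩
    refine ⟨⌊L.slope u⌋, fun t ht => ?_⟩
    rw [hf L hL t ⟨hlx.trans ht.1, ht.2.trans hyh⟩, hf L hL x ⟨hlx, hxy.le.trans hyh⟩,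
      L.interpolation_of_le u (ht.2.trans hy), L.interpolation_of_le u h.le]
    ring
  · refine ⟨⌊L.slope u⌋ + 1, fun t ht => ?_⟩
    rw [hf L hL t ⟨hlx.trans ht.1, ht.2.trans hyh⟩, hf L hL x ⟨hlx, hxy.le.trans hyh⟩,
      L.interpolation_of_ge u (h.trans ht.1), L.interpolation_of_ge u h]
    ring

open Classical in
theorem ord_pt_of_mem_Ioo [Fintype E] (hf : Interpolates S u f) (hL : IsSegmentOf S L) {t : ℝ}
    (ht : L.lo < t ∧ t < L.hi) : G.ord f (G.pt L.edge t) = if t = L.bend u then 1 else 0 := by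
  rw [ord_pt f (L.param_mem_Ioo ht)]
  rcases lt_trichotomy t (L.bend u) with h | h | h
  · rw [if_neg h.ne, hf.slopeFwd_of_lt hL ht.1.le h, hf.slopeBwd_of_le hL ht.1 h.le]
    ring
  · rw [if_pos h, hf.slopeFwd_of_ge hL h.ge ht.2, hf.slopeBwd_of_le hL ht.1 h.le]
    push_cast
    ring
  · rw [if_neg h.ne', hf.slopeFwd_of_ge hL h.le ht.2, hf.slopeBwd_of_gt hL h ht.2.le]
    ring

end Interpolates

theorem IsLoopTransversal.finite [Finite E] {I : Set G.Point} (hI : G.IsLoopTransversal I) :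
    I.Finite := by
  refine (Set.finite_iUnion (f := fun e => {p | G.src e = G.tgt e ∧ p ∈ I ∧ p ∈ G.edgeInterior e})
    fun e => Set.Subsingleton.finite ?_).subset fun p hp => ?_
  · rintro p ⟨he, hp⟩ q ⟨-, hq⟩
    exact (hI.2 e he).unique hp hq
  · obtain ⟨e, he, hpe⟩ := hI.1 p hp
    exact Set.mem_iUnion.2 ⟨e, he, hp, hpe⟩

/-! ### From a reduced potential to a permutation -/

section Burning

variable [Fintype E] (S : Finset G.Point)

/-- The lower end of a segment cut out by `S`, as a node of the subdivided graph. -/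
noncomputable def segmentLo (L : segments S) : S :=
  ⟨G.pt L.1.edge L.1.lo, (mem_segments.1 L.2).1⟩

/-- The upper end of a segment cut out by `S`, as a node of the subdivided graph. -/
noncomputable def segmentHi (L : segments S) : S :=
  ⟨G.pt L.1.edge L.1.hi, (mem_segments.1 L.2).2.1⟩

/-- The length of a segment cut out by `S`. -/
def segmentLength (L : segments S) : ℝ := L.1.hi - L.1.lo

variable {S}

theorem cutConnected_segments (hV : ∀ v, Point.vertex v ∈ S) (s₀ : S) :
    WeightedMultigraph.CutConnected (segmentLo S) (segmentHi S) s₀ := by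
  rintro A ⟨s, hs⟩ hA
  obtain ⟨L, hL, h⟩ := segments_connected (S := (S : Set G.Point)) (A := Subtype.val '' A)
    S.finite_toSet hV s.2 s₀.2 ⟨s, hs, rfl⟩ (by
      rintro ⟨t, ht, heq⟩
      exact hA (Subtype.ext heq ▸ ht))
  have hmem : ∀ t : S, (t : G.Point) ∈ Subtype.val '' A ↔ t ∈ A := fun t =>
    Subtype.val_injective.mem_set_image
  refine ⟨⟨L, mem_segments.2 hL⟩, ?_⟩
  rw [← hmem, ← hmem]
  exact h

theorem Interpolates.ord_of_mem {u f : G.Point → ℝ} (hf : Interpolates (S : Set G.Point) u f)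
    (hV : ∀ v, Point.vertex v ∈ S) (s : S) :
    G.ord f s = WeightedMultigraph.floorLaplacian (segmentLo S) (segmentHi S) (segmentLength S)
      (fun s => u s) s := by
  classical
  rw [ord_eq_sum_segments hV f s.2, ← Finset.sum_coe_sort, WeightedMultigraph.floorLaplacian]
  push_cast
  refine Finset.sum_congr rfl fun L _ => ?_
  have hL := mem_segments.1 L.2
  rw [hf.slopeFwd_lo hL, hf.slopeBwd_hi hL]
  simp only [Subtype.ext_iff, segmentLo, segmentHi, segmentLength]
  congr 1 <;> split_ifs with h
  · rw [← h]
  · rfl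
  · rw [← h]
  · rfl

open Classical in
/-- The points at which the interpolation of `u` has to jump. -/
noncomputable def bendPoints (S : Finset G.Point) (u : G.Point → ℝ) : Finset G.Point :=
  ((segments S).filter fun L => L.bend u < L.hi).image fun L => G.pt L.edge (L.bend u)

theorem mem_bendPoints {u : G.Point → ℝ} {p : G.Point} : p ∈ bendPoints S u ↔
    ∃ L, IsSegmentOf (S : Set G.Point) L ∧ L.bend u < L.hi ∧ G.pt L.edge (L.bend u) = p := by
  simp [bendPoints, mem_segments, and_assoc]

theorem notMem_of_mem_bendPoints {u : G.Point → ℝ} {p : G.Point} (hp : p ∈ bendPoints S u) :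
    p ∉ S := by
  obtain ⟨L, hL, h, rfl⟩ := mem_bendPoints.1 hp
  exact hL.2.2 _ (L.lo_lt_bend u) h

theorem pt_mem_bendPoints_iff {u : G.Point → ℝ} {L : G.Segment}
    (hL : IsSegmentOf (S : Set G.Point) L) {t : ℝ} (ht : L.lo < t ∧ t < L.hi) :
    G.pt L.edge t ∈ bendPoints S u ↔ t = L.bend u := by
  rw [mem_bendPoints]
  constructor
  · rintro ⟨L', hL', h', heq⟩
    obtain ⟨rfl, rfl⟩ := hL'.eq_of_pt_eq hL ⟨L'.lo_lt_bend u, h'⟩ ht heq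
    rfl
  · rintro rfl
    exact ⟨L, hL, ht.2, rfl⟩

open Classical in
theorem Interpolates.ord_of_notMem {u f : G.Point → ℝ}
    (hf : Interpolates (S : Set G.Point) u f) (hV : ∀ v, Point.vertex v ∈ S) {p : G.Point}
    (hp : p ∉ S) : G.ord f p = if p ∈ bendPoints S u then 1 else 0 := by
  cases p with
  | vertex v => exact absurd (hV v) hp
  | internal e t h =>
    rw [← pt_of_mem_Ioo h] at hp ⊢
    obtain ⟨L, hL, rfl, ht⟩ := exists_segment_mem (S := (S : Set G.Point)) S.finite_toSet hV
      h.1 h.2 hp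
    rw [hf.ord_pt_of_mem_Ioo hL ht]
    simp only [pt_mem_bendPoints_iff hL ht]

open Classical in
/-- A divisor without effective equivalents is equivalent to one below the divisor of a
permutation. -/
theorem exists_linEquiv_le_nu {I : Set G.Point} [Fintype V] (hI : G.IsLoopTransversal I)
    (D : G.Divisor) (hD : linearSystem D = ∅) :
    ∃ P : G.Permutation I, ∃ D' : G.Divisor, LinEquiv D' D ∧ 0 ≤ P.nu - D' := by
  let S : Finset G.Point := Finset.univ.image Point.vertex ∪ D.support ∪ hI.finite.toFinset
  have hV : ∀ v, Point.vertex v ∈ S := fun v => by simp [S]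
  have hDS : ∀ p, p ∉ S → D p = 0 := fun p hp => by
    by_contra h
    exact hp (by simp [S, h])
  have hIS : ∀ p ∈ I, p ∈ S := fun p hp => by simp [S, hp]
  obtain ⟨v⟩ := G.nonempty
  let s₀ : S := ⟨.vertex v, hV v⟩
  have hℓ : ∀ L, 0 < segmentLength S L := fun L => sub_pos.2 L.1.lo_lt_hi
  obtain ⟨u₀, hu₀, hburn⟩ := WeightedMultigraph.exists_reduced_potential hℓ
    (cutConnected_segments hV s₀) (fun s => D s)
  let u : G.Point → ℝ := fun p => if h : p ∈ S then u₀ ⟨p, h⟩ else 0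
  have hu : (fun s : S => u s) = u₀ := by
    funext s
    simp [u, s.2]
  obtain ⟨f, hf⟩ := exists_interpolates (S : Set G.Point) u
  let Δ : S → ℤ := fun s => D s + WeightedMultigraph.floorLaplacian (segmentLo S) (segmentHi S)
    (segmentLength S) u₀ s
  obtain ⟨l, hnd, hl, hlb⟩ := exists_burning_order s₀ (fun s B => Δ s <
    (WeightedMultigraph.integralEdges (segmentLo S) (segmentHi S) (segmentLength S) u₀ s B).card)
    hburn
  let D' : G.Divisor := Finsupp.onFinset (S ∪ bendPoints S u)
    (fun p => if h : p ∈ S then Δ ⟨p, h⟩ else if p ∈ bendPoints S u then 1 else 0) (by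
      intro p hp
      by_contra h
      rw [Finset.mem_union, not_or] at h
      simp [h.1, h.2] at hp)
  have hD'S : ∀ s : S, D' s = Δ s := fun s => by simp [D', s.2]
  have hD'B : ∀ p ∉ S, D' p = if p ∈ bendPoints S u then 1 else 0 := fun p hp => by
    simp [D', hp]
  have hequiv : LinEquiv D' D := by
    refine ⟨f, hf.isRational S.finite_toSet hV, fun p => ?_⟩
    by_cases hp : p ∈ S
    · have h1 := hf.ord_of_mem hV ⟨p, hp⟩
      rw [hu] at h1
      rw [h1, hD'S ⟨p, hp⟩]
      simp [Δ]
    · rw [hf.ord_of_notMem hV hp, hD'B p hp, hDS p hp]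
      simp
  -- `D'` is effective away from `s₀`, so a nonnegative value there would put it in the empty linear
  -- system of `D`.
  have hs₀ : Δ s₀ ≤ -1 := by
    by_contra! hcon
    have : D' ∈ linearSystem D := by
      refine ⟨fun p => ?_, hequiv⟩
      by_cases hp : p ∈ S
      · rw [hD'S ⟨p, hp⟩]
        by_cases h : (⟨p, hp⟩ : S) = s₀
        · rw [h]
          simp only [Finsupp.coe_zero, Pi.zero_apply]
          omega
        · exact hu₀ _ h
      · rw [hD'B p hp]
        split_ifs <;> simp
    rw [hD] at this
    exact this
  -- The bends come last, in any order, so that both neighbours of each bend precede it.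
  let lst : List G.Point := l.map Subtype.val ++ (bendPoints S u).toList
  have hmemS : ∀ p, p ∈ l.map Subtype.val ↔ p ∈ S := fun p => by simp [hl]
  have hmem : ∀ p, p ∈ lst ↔ p ∈ S ∨ p ∈ bendPoints S u := fun p => by
    rw [List.mem_append, hmemS, Finset.mem_toList]
  let P : G.Permutation I :=
    { toList := lst
      nodup := by
        rw [List.nodup_append]
        refine ⟨hnd.map Subtype.val_injective, Finset.nodup_toList _, ?_⟩
        rintro p hp _ hq rfl
        exact notMem_of_mem_bendPoints (Finset.mem_toList.1 hq) ((hmemS p).1 hp)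
      vertex_mem := fun v => (hmem _).2 (.inl (hV v))
      transversal_mem := fun p hp => (hmem _).2 (.inl (hIS p hp)) }
  have hidx : ∀ s : S, lst.idxOf (s : G.Point) = l.idxOf s := fun s => by
    rw [List.idxOf_append_of_mem ((hmemS _).2 s.2)]
    exact idxOf_map_of_injective Subtype.val_injective l s
  have hprec : ∀ s t : S, l.idxOf s < l.idxOf t → P.Precedes s t := fun s t h =>
    ⟨(hmem _).2 (.inl s.2), (hmem _).2 (.inl t.2), by
      show lst.idxOf _ < lst.idxOf _
      rwa [hidx, hidx]⟩
  have hprecB : ∀ s : S, ∀ p ∈ bendPoints S u, P.Precedes s p := fun s p hp =>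
    ⟨(hmem _).2 (.inl s.2), (hmem _).2 (.inr hp), by
      show lst.idxOf _ < lst.idxOf _
      rw [List.idxOf_append_of_notMem (a := p)
        (fun h => notMem_of_mem_bendPoints hp ((hmemS p).1 h)), hidx, List.length_map]
      exact (List.idxOf_lt_length_iff.2 (hl s)).trans_le (Nat.le_add_right _ _)⟩
  have hfin : ∀ p, (P.segs p).Finite := fun p =>
    (segments P.supp).finite_toSet.subset (Permutation.segs_subset p)
  refine ⟨P, D', hequiv, fun p => ?_⟩
  rw [Finsupp.sub_apply, Finsupp.coe_zero, Pi.zero_apply, sub_nonneg]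
  by_cases hp : p ∈ S
  · rw [hD'S ⟨p, hp⟩, Permutation.nu_apply_of_mem ((hmem p).2 (.inl hp))]
    by_cases h : (⟨p, hp⟩ : S) = s₀
    · rw [h]
      omega
    -- Burning bounds the coefficient by the number of integral segments to predecessors. These have
    -- no interior bend, so they survive as `P`-segments and belong to `S_P`.
    · refine Int.le_sub_one_of_lt ((hlb _ h).trans_le ?_)
      rw [Int.ofNat_le, ← Finset.card_map (Function.Embedding.subtype _), ← Set.ncard_coe_finset]
      refine Set.ncard_le_ncard (fun L hL => ?_) (hfin p)
      rw [Finset.mem_coe, Finset.mem_map] at hL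
      obtain ⟨L, hL, rfl⟩ := hL
      simp only [WeightedMultigraph.integralEdges, Finset.mem_filter, Finset.mem_univ,
        true_and] at hL
      have hseg := mem_segments.1 L.2
      have hint : L.1.bend u = L.1.hi := by
        rw [L.1.bend_eq_hi_iff u]
        have := hL.1
        rw [← hu] at this
        exact this
      refine ⟨⟨(hmem _).2 (.inl hseg.1), (hmem _).2 (.inl hseg.2.1), fun t h1 h2 h3 => ?_⟩, ?_⟩
      · rcases (hmem _).1 h3 with h4 | h4
        · exact hseg.2.2 t h1 h2 h4
        · have := (pt_mem_bendPoints_iff hseg ⟨h1, h2⟩).1 h4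
          rw [this, hint] at h2
          exact h2.false
      · rcases hL.2 with ⟨h1, h2⟩ | ⟨h1, h2⟩
        · exact .inl ⟨congrArg Subtype.val h1, hprec _ _ h2⟩
        · exact .inr ⟨congrArg Subtype.val h1, hprec _ _ h2⟩
  · rw [hD'B p hp]
    split_ifs with hb
    · rw [Permutation.nu_apply_of_mem ((hmem p).2 (.inr hb))]
      obtain ⟨L, hL, hlt, rfl⟩ := mem_bendPoints.1 hb
      let L₁ : G.Segment := ⟨L.edge, L.lo, L.bend u, L.lo_nonneg, L.lo_lt_bend u,
        hlt.le.trans L.hi_le⟩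
      let L₂ : G.Segment := ⟨L.edge, L.bend u, L.hi, L.lo_nonneg.trans (L.lo_lt_bend u).le,
        hlt, L.hi_le⟩
      have havoid : ∀ t, L.lo < t → t < L.hi → t ≠ L.bend u → G.pt L.edge t ∉ P.toList := by
        intro t h1 h2 h3 h4
        rcases (hmem _).1 h4 with h5 | h5
        · exact hL.2.2 t h1 h2 h5
        · exact h3 ((pt_mem_bendPoints_iff hL ⟨h1, h2⟩).1 h5)
      have h₁ : L₁ ∈ P.segs (G.pt L.edge (L.bend u)) :=
        ⟨⟨(hmem _).2 (.inl hL.1), (hmem _).2 (.inr hb),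
          fun t h1 h2 => havoid t h1 (h2.trans hlt) h2.ne⟩, .inr ⟨rfl, hprecB ⟨_, hL.1⟩ _ hb⟩⟩
      have h₂ : L₂ ∈ P.segs (G.pt L.edge (L.bend u)) :=
        ⟨⟨(hmem _).2 (.inr hb), (hmem _).2 (.inl hL.2.1),
          fun t h1 h2 => havoid t ((L.lo_lt_bend u).trans h1) h2 h1.ne'⟩,
          .inl ⟨rfl, hprecB ⟨_, hL.2.1⟩ _ hb⟩⟩
      -- Two distinct segments at the bend give `nu` a coefficient of at least `1`, the value of
      -- `D'` there.
      have hne : L₁ ≠ L₂ := fun h => (L.lo_lt_bend u).ne (congrArg Segment.lo h)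
      have hsub : ({L₁, L₂} : Set G.Segment) ⊆ P.segs (G.pt L.edge (L.bend u)) :=
        Set.insert_subset h₁ (Set.singleton_subset_iff.2 h₂)
      have := Set.ncard_le_ncard hsub (hfin _)
      rw [Set.ncard_pair hne] at this
      omega
    · rw [Permutation.nu_apply_of_notMem fun h => ((hmem p).1 h).elim hp hb]

end Burning

end MetricGraph

/-! ### The dichotomy and non-special divisors -/

theorem mainTheorem6 {V E : Type*} [Fintype V] [Fintype E] (G : MetricGraph V E)
    (I : Set G.Point) (hI : G.IsLoopTransversal I) :
    (∀ D : G.Divisor,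
      Xor (0 ≤ MetricGraph.rank D)
        (∃ P : G.Permutation I, 0 ≤ MetricGraph.rank (P.nu - D))) ∧
    (∀ D : G.Divisor, MetricGraph.IsNonSpecial D →
      ∃ P : G.Permutation I, MetricGraph.LinEquiv D P.nu) := by
  refine ⟨fun D => ?_, fun D hD => ?_⟩
  · simp only [MetricGraph.rank_nonneg_iff]
    by_cases hD : (MetricGraph.linearSystem D).Nonempty
    · refine .inl ⟨hD, ?_⟩
      rintro ⟨P, F', hF', hF'D⟩
      obtain ⟨F, hF, hFD⟩ := hD
      -- Effective representatives of `P.nu - D` and `D` would add up to one of `P.nu`.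
      have : F' + F ∈ MetricGraph.linearSystem P.nu :=
        ⟨add_nonneg hF' hF, by simpa using MetricGraph.linEquiv_add hF'D hFD⟩
      rw [MetricGraph.Permutation.linearSystem_nu_eq_empty] at this
      exact this
    · obtain ⟨P, D', hD', hle⟩ := MetricGraph.exists_linEquiv_le_nu hI D
        (Set.not_nonempty_iff_eq_empty.1 hD)
      exact .inr ⟨⟨P, P.nu - D', hle, MetricGraph.linEquiv_sub_left hD' _⟩, hD⟩
  · obtain ⟨P, D', hD', hle⟩ := MetricGraph.exists_linEquiv_le_nu hI D hD.2
    -- Both divisors have degree `g - 1`, so the effective difference is zero.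
    have heq : D' = P.nu := MetricGraph.eq_of_le_of_deg_eq hle (by
      rw [MetricGraph.deg_eq_of_linEquiv hD', hD.1, MetricGraph.Permutation.deg_nu hI])
    exact ⟨P, heq ▸ MetricGraph.linEquiv_symm hD'⟩
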